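/- Let $n\ge 2$. Let $B_n$ be the group of bijections $\sigma$ of $\{\pm1,\dots,\pm n\}$ with $\sigma(-i)=-\sigma(i)$, written as words $\sigma=\sigma_1\cdots\sigma_n$ with $\sigma_i=\sigma(i)$, and let $D_n$ be the subgroup of those $\sigma$ whose word contains an even number of negative letters. For $1\le |i|\le j\le n$, $i\ne j$, let $(i,j)\in B_n$ be the signed transposition that exchanges $i$ with $j$ and $-i$ with $-j$ (for $i=-j$ it only exchanges $j$ and $-j$). Let $\chi(P)$ be $1$ if $P$ holds and $0$ otherwise. For $\sigma\in D_n$ define: - $\mathrm{inv}_D(\sigma)=|\{(i,j):1\le i<j\le n,\ \sigma_i>\sigma_j\}|+|\{(i,j):1\le i<j\le n,\ -\sigma_i>\sigma_j\}|$; - $\mathrm{nmin}_D(\sigma)=|\{i:\sigma_i>|\sigma_j|\text{ for some }j>i\}|+|\{i:\sigma_i<-1\}|$, where $1\le i,j\le n$; - $\mathrm{sor}_D(\sigma)=\sum_{r=1}^k\bigl(j_r-i_r-2\chi(i_r<0)\bigr)$, where $\sigma=(i_1,j_1)(i_2,j_2)\cdots(i_k,j_k)$ is the unique factorization of $\sigma$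 into signed transpositions as above with $0<j_1<j_2<\cdots<j_k\le n$; - $\tilde l'_D(\sigma)$ is the minimal number of elements of $T^D=\{(i,j):1\le|i|<j\le n\}\cup\{(-i,i)(-1,1):1<i\le n\}$ whose product is $\sigma$. Then the pairs $(\mathrm{inv}_D,\mathrm{nmin}_D)$ and $(\mathrm{sor}_D,\tilde l'_D)$ are equidistributed over $D_n$: for all integers $a,b\ge 0$, as many $\sigma\in D_n$ satisfy $\mathrm{inv}_D(\sigma)=a$, $\mathrm{nmin}_D(\sigma)=b$ as satisfy $\mathrm{sor}_D(\sigma)=a$, $\tilde l'_D(\sigma)=b$. Moreover, with $[m]_q=1+q+\cdots+q^{m-1}$, $$\sum_{\sigma\in D_n}q^{\mathrm{inv}_D(\sigma)}t^{\mathrm{nmin}_D(\sigma)}=\prod_{r=1}^{n-1}\bigl(1+q^rt+qt\,[2r]_q\bigr),\qquad \sum_{\sigma\in D_n}q^{\mathrm{sor}_D(\sigma)}t^{\tilde l'_D(\sigma)}=\prod_{r=1}^{n-1}\bigl(1+q^rt+qt\,[2r]_q\bigr).$$ -/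

import Mathlib

namespace TypeD

open Equiv

/-- The set `{1, …, n, -1, …, -n}` on which signed permutations act. -/
abbrev Letter (n : ℕ) : Type := {x : ℤ // x ≠ 0 ∧ |x| ≤ (n : ℤ)}

noncomputable instance (n : ℕ) : Fintype (Letter n) :=
  Fintype.subtype ((Finset.Icc (-(n : ℤ)) n).erase 0) (by
    intro x
    simp [abs_le])

instance (n : ℕ) : InvolutiveNeg (Letter n) where
  neg x := ⟨-x.1, neg_ne_zero.mpr x.2.1, by rw [abs_neg]; exact x.2.2⟩
  neg_neg x := Subtype.ext (neg_neg x.1)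

@[simp] theorem coe_neg {n : ℕ} (x : Letter n) : ((-x : Letter n) : ℤ) = -(x : ℤ) := rfl

/-- The hyperoctahedral group `B_n`: the bijections `σ` of `{±1, …, ±n}` with `σ(-i) = -σ(i)`.
The word of `σ` is `σ(1) σ(2) ⋯ σ(n)`, and the group law is composition of maps. -/
def hyperoctahedral (n : ℕ) : Subgroup (Perm (Letter n)) where
  carrier := {σ | ∀ x, σ (-x) = -σ x}
  one_mem' := fun _ => rfl
  mul_mem' := by
    intro a b ha hb x
    simp only [Set.mem_ofPred_eq] at ha hb
    simp [Perm.mul_apply, ha, hb]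
  inv_mem' := by
    intro a ha x
    simp only [Set.mem_ofPred_eq] at ha
    rw [Perm.inv_eq_iff_eq, ha]
    simp

/-- `N(σ)`: the number of minus signs in the word of `σ`. -/
noncomputable def numNeg {n : ℕ} (σ : Perm (Letter n)) : ℕ :=
  (Finset.univ.filter fun i : Letter n => 0 < (i : ℤ) ∧ (σ i : ℤ) < 0).card

/-- The letter `|x|`. -/
def absLetter {n : ℕ} (x : Letter n) : Letter n :=
  ⟨|x.1|, abs_ne_zero.mpr x.2.1, by rw [abs_abs]; exact x.2.2⟩

theorem prod_sign_eq {n : ℕ} (σ : Perm (Letter n)) :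
    ∏ i ∈ Finset.univ.filter (fun i : Letter n => 0 < (i : ℤ)), (if (σ i : ℤ) < 0 then (-1 : ℤ) else 1)
      = (-1) ^ numNeg σ := by
  rw [Finset.prod_ite, Finset.prod_const_one, mul_one, Finset.prod_const, numNeg,
    Finset.filter_filter]

theorem neg_one_pow_numNeg_mul {n : ℕ} {σ τ : Perm (Letter n)}
    (hσ : σ ∈ hyperoctahedral n) (hτ : τ ∈ hyperoctahedral n) :
    (-1 : ℤ) ^ numNeg (σ * τ) = (-1) ^ numNeg σ * (-1) ^ numNeg τ := by
  have hσ' : ∀ x, σ (-x) = -σ x := hσ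
  have hτ' : ∀ x, τ (-x) = -τ x := hτ
  have habs : ∀ x : Letter n, absLetter x = x ∨ absLetter x = -x := by
    intro x
    rcases abs_choice (x : ℤ) with h | h
    · exact Or.inl (Subtype.ext h)
    · exact Or.inr (Subtype.ext h)
  have hre : ∏ i ∈ Finset.univ.filter (fun i : Letter n => 0 < (i : ℤ)), (if (σ i : ℤ) < 0 then (-1 : ℤ) else 1)
      = ∏ i ∈ Finset.univ.filter (fun i : Letter n => 0 < (i : ℤ)),
          (if (σ (absLetter (τ i)) : ℤ) < 0 then (-1 : ℤ) else 1) := by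
    symm
    refine Finset.prod_nbij' (fun i => absLetter (τ i)) (fun i => absLetter (τ⁻¹ i)) ?_ ?_ ?_ ?_ ?_
    · intro i _
      simpa [absLetter] using (τ i).2.1
    · intro i _
      simpa [absLetter] using (τ⁻¹ i).2.1
    · intro i hi
      have hi : 0 < (i : ℤ) := by simpa using hi
      apply Subtype.ext
      have : (τ⁻¹ (absLetter (τ i)) : ℤ) = i ∨ (τ⁻¹ (absLetter (τ i)) : ℤ) = -i := by
        rcases habs (τ i) with h | h
        · left; rw [h]; simp
        · right; rw [h, ← hτ']; simp
      change |(τ⁻¹ (absLetter (τ i)) : ℤ)| = i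
      rcases this with h | h <;> rw [h] <;> simp [abs_of_pos hi]
    · intro i hi
      have hi : 0 < (i : ℤ) := by simpa using hi
      apply Subtype.ext
      have : (τ (absLetter (τ⁻¹ i)) : ℤ) = i ∨ (τ (absLetter (τ⁻¹ i)) : ℤ) = -i := by
        rcases habs (τ⁻¹ i) with h | h
        · left; rw [h]; simp
        · right; rw [h, hτ']; simp
      change |(τ (absLetter (τ⁻¹ i)) : ℤ)| = i
      rcases this with h | h <;> rw [h] <;> simp [abs_of_pos hi]
    · intro i _
      rfl
  rw [← prod_sign_eq, ← prod_sign_eq, ← prod_sign_eq, hre, ← Finset.prod_mul_distrib]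
  refine Finset.prod_congr rfl fun i _ => ?_
  have h0 := (τ i).2.1
  have h1 := (σ (τ i)).2.1
  rw [Perm.mul_apply]
  rcases lt_or_gt_of_ne h0 with h | h
  · have : absLetter (τ i) = -τ i := Subtype.ext (abs_of_neg h)
    rw [this, hσ', coe_neg, if_pos h]
    rcases lt_or_gt_of_ne h1 with h' | h'
    · rw [if_pos h', if_neg (by omega)]; norm_num
    · rw [if_neg (by omega), if_pos (by omega)]; norm_num
  · have : absLetter (τ i) = τ i := Subtype.ext (abs_of_pos h)
    rw [this, if_neg (by omega : ¬ (τ i : ℤ) < 0), mul_one]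

/-- The group `D_n`: the elements of `B_n` whose word has an even number of minus signs. -/
def typeD (n : ℕ) : Subgroup (Perm (Letter n)) where
  carrier := {σ | σ ∈ hyperoctahedral n ∧ Even (numNeg σ)}
  one_mem' := by
    refine ⟨one_mem _, ?_⟩
    have : numNeg (1 : Perm (Letter n)) = 0 := by
      rw [numNeg, Finset.card_eq_zero, Finset.filter_eq_empty_iff]
      intro i _ h
      have := h.2
      rw [Perm.one_apply] at this
      omega
    rw [this]
    exact Even.zero
  mul_mem' := by
    rintro a b ⟨ha, ha'⟩ ⟨hb, hb'⟩
    refine ⟨mul_mem ha hb, ?_⟩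
    have h := neg_one_pow_numNeg_mul ha hb
    rw [ha'.neg_one_pow, hb'.neg_one_pow, mul_one] at h
    exact (neg_one_pow_eq_one_iff_even (by norm_num)).mp h
  inv_mem' := by
    rintro a ⟨ha, ha'⟩
    refine ⟨inv_mem ha, ?_⟩
    have h := neg_one_pow_numNeg_mul ha (inv_mem ha)
    rw [ha'.neg_one_pow, one_mul, mul_inv_cancel] at h
    have h1 := neg_one_pow_numNeg_mul (one_mem (hyperoctahedral n)) (one_mem (hyperoctahedral n))
    rw [mul_one] at h1
    have h2 : (-1 : ℤ) ^ numNeg (1 : Perm (Letter n)) = 1 := by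
      rcases neg_one_pow_eq_or ℤ (numNeg (1 : Perm (Letter n))) with h3 | h3
      · exact h3
      · rw [h3] at h1; norm_num at h1
    rw [h2] at h
    exact (neg_one_pow_eq_one_iff_even (by norm_num)).mp h.symm

noncomputable instance (n : ℕ) : Fintype (typeD n) := Fintype.ofFinite _

/-- The type `D` inversion number:
`#{1 ≤ i < j ≤ n : σ_i > σ_j} + #{1 ≤ i < j ≤ n : -σ_i > σ_j}`. -/
noncomputable def invD {n : ℕ} (σ : Perm (Letter n)) : ℕ :=
  (Finset.univ.filter fun p : Letter n × Letter n =>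
      0 < (p.1 : ℤ) ∧ (p.1 : ℤ) < p.2 ∧ (σ p.2 : ℤ) < σ p.1).card
  + (Finset.univ.filter fun p : Letter n × Letter n =>
      0 < (p.1 : ℤ) ∧ (p.1 : ℤ) < p.2 ∧ (σ p.2 : ℤ) < -(σ p.1 : ℤ)).card

/-- The number of positions `i` with `σ_i > |σ_j|` for some `j > i`, plus the number of minus signs
in the word of `σ` that are attached to elements greater than `1`. -/
noncomputable def nminD {n : ℕ} (σ : Perm (Letter n)) : ℕ :=
  (Finset.univ.filter fun i : Letter n =>
      0 < (i : ℤ) ∧ ∃ j : Letter n, (i : ℤ) < j ∧ |(σ j : ℤ)| < σ i).card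
  + (Finset.univ.filter fun i : Letter n => 0 < (i : ℤ) ∧ (σ i : ℤ) < -1).card

/-- The signed transposition `(i, j)`: it exchanges `i` with `j` and `-i` with `-j` if `i ≠ -j`,
and exchanges `i` with `-i` if `i = -j`. -/
def signedSwap {n : ℕ} (i j : Letter n) : Perm (Letter n) :=
  if i = -j then swap i j else swap i j * swap (-i) (-j)

/-- `L = [(i₁, j₁), …, (i_k, j_k)]` encodes a factorization `σ = (i₁, j₁) ⋯ (i_k, j_k)` into
reflections of `B_n`, that is, signed transpositions `(i, j)` with `1 ≤ i < j ≤ n` or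
`(-i, j)` with `1 ≤ i ≤ j ≤ n`, where `0 < j₁ < ⋯ < j_k ≤ n`. -/
def IsSortFactorization {n : ℕ} (σ : Perm (Letter n)) (L : List (Letter n × Letter n)) : Prop :=
  (∀ p ∈ L, 0 < (p.2 : ℤ) ∧ |(p.1 : ℤ)| ≤ p.2 ∧ p.1 ≠ p.2) ∧
  (L.map Prod.snd).Pairwise (· < ·) ∧
  (L.map fun p => signedSwap p.1 p.2).prod = σ

/-- The sum of `j - i - 2χ(i < 0)` over the pairs `(i, j)` in `L`; for the pairs that occur in a
factorization as above each summand is a nonnegative integer. -/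
def sortWeight {n : ℕ} (L : List (Letter n × Letter n)) : ℕ :=
  (L.map fun p => ((p.2 : ℤ) - p.1 - (if (p.1 : ℤ) < 0 then 2 else 0)).toNat).sum

theorem signedSwap_apply_left {n : ℕ} (i j : Letter n) : signedSwap i j i = j := by
  unfold signedSwap
  split_ifs with h'
  · simp
  · have h1 : i ≠ -i := by
      intro h2
      have := congrArg Subtype.val h2
      have := i.2.1
      simp only [coe_neg] at *
      omega
    have h2 : swap (-i) (-j) i = i := swap_apply_of_ne_of_ne h1 h'
    rw [Perm.mul_apply, h2, swap_apply_left]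

theorem signedSwap_apply_of_abs_lt {n : ℕ} (i j x : Letter n)
    (hi : |(i : ℤ)| < x) (hj : |(j : ℤ)| < x) : signedSwap i j x = x := by
  have key : ∀ a : Letter n, |(a : ℤ)| < x → x ≠ a ∧ x ≠ -a := by
    intro a ha
    have := abs_lt.mp ha
    constructor
    · rintro rfl; exact absurd (le_abs_self (x : ℤ)) (by omega)
    · intro h
      have := congrArg Subtype.val h
      simp only [coe_neg] at this
      omega
  unfold signedSwap
  split_ifs
  · exact swap_apply_of_ne_of_ne (key i hi).1 (key j hj).1
  · rw [Perm.mul_apply, swap_apply_of_ne_of_ne (key i hi).2 (key j hj).2,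
      swap_apply_of_ne_of_ne (key i hi).1 (key j hj).1]

theorem signedSwap_mem {n : ℕ} (i j : Letter n) : signedSwap i j ∈ hyperoctahedral n := by
  intro x
  unfold signedSwap
  split_ifs with h
  · subst h
    simp only [swap_apply_def]
    have h0 : -j ≠ j := by
      intro h
      have := congrArg Subtype.val h
      have := j.2.1
      simp only [coe_neg] at *
      omega
    by_cases h1 : x = j
    · subst h1; simp [h0.symm]
    · by_cases h2 : x = -j
      · subst h2; simp [h0.symm]
      · have : -x ≠ j := fun h => h2 (by rw [← h, neg_neg])
        simp [h1, h2, this]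
  · have hne : ∀ a : Letter n, -a ≠ a := by
      intro a h
      have := congrArg Subtype.val h
      have := a.2.1
      simp only [coe_neg] at *
      omega
    have h' : j ≠ -i := fun h2 => h (by rw [h2, neg_neg])
    have e1 : ∀ y : Letter n, swap i j (-y) = -swap (-i) (-j) y := by
      intro y
      simp only [swap_apply_def, neg_eq_iff_eq_neg]
      split_ifs <;> simp
    have e2 : ∀ y : Letter n, swap (-i) (-j) (-y) = -swap i j y := by
      intro y
      simp only [swap_apply_def, neg_inj]
      split_ifs <;> simp
    have hcomm : swap i j * swap (-i) (-j) = swap (-i) (-j) * swap i j := by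
      apply Perm.Disjoint.commute
      intro y
      simp only [swap_apply_def]
      by_cases hy1 : y = i
      · right; subst hy1; simp [(hne y).symm, h]
      · by_cases hy2 : y = j
        · right; subst hy2; simp [(hne y).symm, h']
        · left; simp [hy1, hy2]
    rw [Perm.mul_apply, e2, e1, ← Perm.mul_apply, hcomm]

/-- Every element of `B_n` that fixes all letters larger than `m` has one and only one
factorization as above, all of whose second entries are at most `m`. -/
theorem existsUnique_sortFactorization_aux {n : ℕ} (m : ℕ) :
    ∀ σ ∈ hyperoctahedral n, (∀ x : Letter n, (m : ℤ) < x → σ x = x) →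
      ∃! L : List (Letter n × Letter n),
        IsSortFactorization σ L ∧ ∀ p ∈ L, (p.2 : ℤ) ≤ m := by
  induction m with
  | zero =>
    intro σ hσ hfix
    have hσ' : ∀ x, σ (-x) = -σ x := hσ
    have h1 : σ = 1 := by
      ext1 x
      rcases lt_or_gt_of_ne x.2.1 with h | h
      · have := hfix (-x) (by simpa using h)
        rw [hσ', neg_inj] at this
        exact this
      · exact hfix x (by simpa using h)
    refine ⟨[], ⟨⟨by simp, by simp, by simp [h1]⟩, by simp⟩, ?_⟩
    rintro L ⟨⟨hL, -, -⟩, hL'⟩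
    rw [List.eq_nil_iff_forall_not_mem]
    intro p hp
    have := (hL p hp).1
    have := hL' p hp
    push_cast at this
    omega
  | succ m ih =>
    intro σ hσ hfix
    have hσ' : ∀ x, σ (-x) = -σ x := hσ
    by_cases hm : m + 1 ≤ n
    swap
    · have hle : ∀ x : Letter n, (x : ℤ) ≤ m := fun x => by
        have := (le_abs_self _).trans x.2.2
        omega
      obtain ⟨L, ⟨h1, -⟩, h3⟩ := ih σ hσ (fun x hx => absurd (hle x) (by omega))
      refine ⟨L, ⟨h1, fun p _ => ?_⟩, fun L' hL' => h3 L' ⟨hL'.1, fun p _ => hle p.2⟩⟩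
      have := hle p.2
      push_cast
      omega
    let M : Letter n := ⟨(m : ℤ) + 1, by omega, by rw [abs_of_nonneg (by omega)]; exact_mod_cast hm⟩
    have hM : (M : ℤ) = (m : ℤ) + 1 := rfl
    have prodFix : ∀ (L : List (Letter n × Letter n)) (x : Letter n),
        (∀ p ∈ L, |(p.1 : ℤ)| < x ∧ |(p.2 : ℤ)| < x) →
        (L.map fun p => signedSwap p.1 p.2).prod x = x := by
      intro L x hL
      induction L with
      | nil => rfl
      | cons p L ihL =>
        rw [List.map_cons, List.prod_cons, Perm.mul_apply,
          ihL (fun q hq => hL q (List.mem_cons_of_mem _ hq)),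
          signedSwap_apply_of_abs_lt _ _ _ (hL p List.mem_cons_self).1
            (hL p List.mem_cons_self).2]
    have prodFix' : ∀ (L : List (Letter n × Letter n)),
        (∀ p ∈ L, 0 < (p.2 : ℤ) ∧ |(p.1 : ℤ)| ≤ p.2 ∧ p.1 ≠ p.2) →
        (∀ p ∈ L, (p.2 : ℤ) ≤ m) → ∀ x : Letter n, (m : ℤ) < x →
        (L.map fun p => signedSwap p.1 p.2).prod x = x := by
      intro L h1 h2 x hx
      refine prodFix L x fun p hp => ?_
      have a1 := h1 p hp
      have a2 := h2 p hp
      rw [abs_of_pos a1.1]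
      omega
    -- A factorization with second entries at most `m + 1` either has all of them at most `m`,
    -- or ends in a pair `(i, m + 1)`.
    have split : ∀ L : List (Letter n × Letter n), ∀ τ, IsSortFactorization τ L →
        (∀ p ∈ L, (p.2 : ℤ) ≤ m + 1) → (∀ p ∈ L, (p.2 : ℤ) ≤ m) ∨
        ∃ L' i, L = L' ++ [(i, M)] ∧ (∀ p ∈ L', (p.2 : ℤ) ≤ m) ∧ i ≠ M ∧
          IsSortFactorization (τ * (signedSwap i M)⁻¹) L' := by
      rintro L τ ⟨h1, h2, h3⟩ h4
      rcases List.eq_nil_or_concat L with rfl | ⟨L', ⟨i, j⟩, rfl⟩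
      · left; simp
      rw [List.concat_eq_append] at *
      rw [List.map_append, List.pairwise_append] at h2
      have h2b : ∀ p ∈ L', (p.2 : ℤ) < j := by
        intro p hp
        exact h2.2.2 p.2 (List.mem_map_of_mem hp) j (by simp)
      have hj := h4 (i, j) (by simp)
      by_cases hjm : (j : ℤ) ≤ m
      · left
        intro p hp
        rcases List.mem_append.mp hp with h | h
        · have := h2b p h
          omega
        · rw [List.mem_singleton.mp h]; exact hjm
      · right
        have hjM : j = M := Subtype.ext (by rw [hM]; simp only at hj; omega)
        subst hjM
        refine ⟨L', i, rfl, fun p hp => ?_, (h1 (i, M) (by simp)).2.2, ?_, h2.1, ?_⟩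
        · have := h2b p hp
          omega
        · exact fun p hp => h1 p (List.mem_append_left _ hp)
        · rw [← h3]
          simp
    by_cases hc : σ M = M
    · have hfix' : ∀ x : Letter n, (m : ℤ) < x → σ x = x := by
        intro x hx
        by_cases hx' : (x : ℤ) = m + 1
        · rw [show x = M from Subtype.ext hx']; exact hc
        · exact hfix x (by push_cast; omega)
      obtain ⟨L, ⟨h1, h2⟩, h3⟩ := ih σ hσ hfix'
      refine ⟨L, ⟨h1, fun p hp => ?_⟩, ?_⟩
      · have := h2 p hp
        push_cast
        omega
      · rintro L₁ ⟨hL₁, hL₁'⟩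
        rcases split L₁ σ hL₁ (by simpa using hL₁') with h | ⟨L', i, rfl, h5, h6, h7⟩
        · exact h3 L₁ ⟨hL₁, h⟩
        · exfalso
          have h8 := prodFix' L' h7.1 h5 M (by omega)
          rw [h7.2.2, Perm.mul_apply,
            Perm.inv_eq_iff_eq.mpr (signedSwap_apply_left i M).symm] at h8
          exact h6 (σ.injective (h8.trans hc.symm))
    · set i : Letter n := σ⁻¹ M with hi
      have hiM : i ≠ M := by
        intro h
        exact hc (Perm.inv_eq_iff_eq.mp h).symm
      have hσi : σ i = M := by simp [hi]
      have habs : |(i : ℤ)| ≤ m + 1 := by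
        by_contra hlt
        push Not at hlt
        rcases abs_choice (i : ℤ) with h | h
        · have := hfix i (by push_cast; omega)
          exact hiM (this.symm.trans hσi)
        · have := hfix (-i) (by rw [coe_neg]; push_cast; omega)
          rw [hσ', neg_inj] at this
          exact hiM (this.symm.trans hσi)
      have hfix' : ∀ x : Letter n, (m : ℤ) < x → (σ * (signedSwap i M)⁻¹) x = x := by
        intro x hx
        rw [Perm.mul_apply]
        by_cases hx' : (x : ℤ) = m + 1
        · rw [show x = M from Subtype.ext hx',
            Perm.inv_eq_iff_eq.mpr (signedSwap_apply_left i M).symm, hσi]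
        · have : (signedSwap i M)⁻¹ x = x := by
            rw [Perm.inv_eq_iff_eq, signedSwap_apply_of_abs_lt]
            · omega
            · rw [hM, abs_of_pos (by omega)]; omega
          rw [this]
          exact hfix x (by push_cast; omega)
      obtain ⟨L, ⟨⟨h1a, h1b, h1c⟩, h2⟩, h3⟩ :=
        ih (σ * (signedSwap i M)⁻¹) (mul_mem hσ (inv_mem (signedSwap_mem i M))) hfix'
      refine ⟨L ++ [(i, M)], ⟨⟨?_, ?_, ?_⟩, ?_⟩, ?_⟩
      · intro p hp
        rcases List.mem_append.mp hp with h | h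
        · exact h1a p h
        · rw [List.mem_singleton.mp h]
          exact ⟨by simp only [hM]; omega, by simp only [hM]; exact habs, hiM⟩
      · rw [List.map_append, List.pairwise_append]
        refine ⟨h1b, by simp, ?_⟩
        intro a ha b hb
        obtain ⟨p, hp, rfl⟩ := List.mem_map.mp ha
        have hb : b = M := by simpa using hb
        subst hb
        have := h2 p hp
        rw [← Subtype.coe_lt_coe, hM]
        omega
      · rw [List.map_append, List.prod_append, h1c]
        simp
      · intro p hp
        rcases List.mem_append.mp hp with h | h
        · have := h2 p h
          push_cast
          omega
        · rw [List.mem_singleton.mp h]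
          push_cast
          exact hM.le
      · rintro L₁ ⟨hL₁, hL₁'⟩
        rcases split L₁ σ hL₁ (by simpa using hL₁') with h | ⟨L', k, rfl, h5, h6, h7⟩
        · exfalso
          have h8 := prodFix' L₁ hL₁.1 h M (by omega)
          rw [hL₁.2.2] at h8
          exact hc h8
        · have h8 := prodFix' L' h7.1 h5 M (by omega)
          rw [h7.2.2, Perm.mul_apply,
            Perm.inv_eq_iff_eq.mpr (signedSwap_apply_left k M).symm] at h8
          have hk : k = i := σ.injective (h8.trans hσi.symm)
          subst hk
          rw [h3 L' ⟨h7, h5⟩]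

/-- The factorization exists and is unique for every element of `B_n`. -/
theorem existsUnique_sortFactorization {n : ℕ} {σ : Perm (Letter n)}
    (hσ : σ ∈ hyperoctahedral n) : ∃! L, IsSortFactorization σ L := by
  have hle : ∀ x : Letter n, (x : ℤ) ≤ n := fun x => (le_abs_self _).trans x.2.2
  obtain ⟨L, ⟨h1, -⟩, h3⟩ := existsUnique_sortFactorization_aux n σ hσ
    (fun x hx => absurd (hle x) (by omega))
  exact ⟨L, h1, fun L' hL' => h3 L' ⟨hL', fun p _ => hle p.2⟩⟩

/-- The type `D` sorting index: the sum of `j_r - i_r - 2χ(i_r < 0)` over the unique factorization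
`σ = (i₁, j₁) ⋯ (i_k, j_k)`, `0 < j₁ < ⋯ < j_k ≤ n`, into reflections of `B_n`. -/
noncomputable def sorD {n : ℕ} (σ : typeD n) : ℕ :=
  sortWeight (existsUnique_sortFactorization σ.2.1).choose

/-- The set `T^D`: the signed transpositions `t_{ij} = (i, j)` with `1 ≤ |i| < j ≤ n`, and the
elements `(-i, i)(-1, 1)` with `1 < i ≤ n`. -/
def reflD (n : ℕ) : Set (Perm (Letter n)) :=
  {g | ∃ i j : Letter n, |(i : ℤ)| < j ∧ g = signedSwap i j} ∪
  {g | ∃ i e : Letter n, (e : ℤ) = 1 ∧ 1 < (i : ℤ) ∧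
    g = signedSwap (-i) i * signedSwap (-e) e}

/-- The minimal number of elements of `T^D` whose product is `σ`. -/
noncomputable def reflLenD {n : ℕ} (σ : typeD n) : ℕ :=
  sInf {k | ∃ L : List (Perm (Letter n)),
    L.length = k ∧ (∀ g ∈ L, g ∈ reflD n) ∧ L.prod = (σ : Perm (Letter n))}

/-- The `q`-integer `[m]_q = 1 + q + ⋯ + q^(m-1)`. -/
def qInt {R : Type*} [CommRing R] (q : R) (m : ℕ) : R := ∑ k ∈ Finset.range m, q ^ k

end TypeD

namespace TypeD
open Equiv

/-! Both generating functions are computed by one recursion along the chain B_1 ⊂ B_2 ⊂ ⋯ ⊂ B_n,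
with B_m realised as `level n m`. Write M = m + 1. An element σ of B_{m+1} lies in a right coset B_m
c_x determined by x = σ⁻¹(M), and x runs over the 2M letters with |x| ≤ M. Suppose the
representatives c_x can be chosen so that passing from τ in B_m to τ c_x adds the weight M - x -
2χ(x < 0) to the first statistic and χ(x ≠ M) to the second. Summing over x then yields the factor 1
+ q^m t + qt[2m]_q (`sum_pow_swapWeight`). Parity is no obstacle: the two elements of B_1 have
opposite parity and both statistics vanish on them, so the even and the odd elements of each B_m
have the same generating function, and the recursion descends to D_n (`sum_typeD_eq_prod`).

For (sor, l̃') take c_x = (x, M), with the identity for x = M. The sorting factorization grows by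
one last pair (`sortIndex_mul`). The reflection length equals `reducedLength`, the smaller of the
codimensions of the fixed spaces of σ and sσ, where s is the sign change of the letter 1; both
codimensions grow by exactly one (`codimFix_mul_signedSwap`, `reflLenD_eq_reducedLength`).

For (inv, nmin) let c_x insert M, with the sign of x, at position |x| of the word. The pairs and
positions away from |x| behave as in τ, and those that involve the new letter are counted directly
(`invD_mul_insertion`, `nminD_mul_insertion`).

Equidistribution follows by comparing coefficients (`card_eq_of_sum_eq`). -/

/-! ### Letters, the chain of subgroups B_m, and sign changes. -/

theorem Letter.le {n : ℕ} (x : Letter n) : (x : ℤ) ≤ n := (le_abs_self _).trans x.2.2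

theorem Letter.neg_ne {n : ℕ} (x : Letter n) : -x ≠ x := by
  intro h
  have h1 := congrArg Subtype.val h
  have h2 := x.2.1
  simp only [coe_neg] at h1
  omega

/-- The positive letter `m + 1`. -/
def topLetter {n : ℕ} (m : ℕ) (h : m < n) : Letter n :=
  ⟨(m : ℤ) + 1, by omega, by rw [abs_of_nonneg (by omega)]; exact_mod_cast h⟩

@[simp] theorem coe_topLetter {n : ℕ} (m : ℕ) (h : m < n) :
    ((topLetter m h : Letter n) : ℤ) = (m : ℤ) + 1 := rfl

/-- The copy of `B_m` in `B_n`: the elements that fix all letters larger than `m`. -/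
def level (n m : ℕ) : Subgroup (Perm (Letter n)) where
  carrier := {σ | σ ∈ hyperoctahedral n ∧ ∀ x : Letter n, (m : ℤ) < x → σ x = x}
  one_mem' := ⟨one_mem _, fun _ _ => rfl⟩
  mul_mem' := by
    rintro a b ⟨ha, ha'⟩ ⟨hb, hb'⟩
    exact ⟨mul_mem ha hb, fun x hx => by rw [Perm.mul_apply, hb' x hx, ha' x hx]⟩
  inv_mem' := by
    rintro a ⟨ha, ha'⟩
    exact ⟨inv_mem ha, fun x hx => by rw [Perm.inv_eq_iff_eq, ha' x hx]⟩

theorem level_neg {n m : ℕ} {σ : Perm (Letter n)} (h : σ ∈ level n m) (x : Letter n) :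
    σ (-x) = -σ x := h.1 x

theorem level_fix {n m : ℕ} {σ : Perm (Letter n)} (h : σ ∈ level n m) (x : Letter n)
    (hx : (m : ℤ) < |(x : ℤ)|) : σ x = x := by
  rcases abs_choice (x : ℤ) with h' | h'
  · exact h.2 x (by omega)
  · have h1 := h.2 (-x) (by rw [coe_neg]; omega)
    rwa [level_neg h, neg_inj] at h1

theorem level_abs_le {n m : ℕ} {σ : Perm (Letter n)} (h : σ ∈ level n m) (x : Letter n)
    (hx : |(x : ℤ)| ≤ m) : |(σ x : ℤ)| ≤ m := by
  by_contra! hlt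
  have h1 := level_fix h (σ x) hlt
  rw [σ.injective h1] at hlt
  omega

theorem level_mono {n m k : ℕ} (h : m ≤ k) : level n m ≤ level n k := fun _ hσ =>
  ⟨hσ.1, fun x hx => hσ.2 x (by omega)⟩

theorem level_self (n : ℕ) : level n n = hyperoctahedral n := by
  ext σ
  exact ⟨fun h => h.1, fun h => ⟨h, fun x hx => absurd x.le (by omega)⟩⟩

theorem numNeg_one {n : ℕ} : numNeg (1 : Perm (Letter n)) = 0 := by
  rw [numNeg, Finset.card_eq_zero, Finset.filter_eq_empty_iff]
  intro i _ h
  have := h.2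
  rw [Perm.one_apply] at this
  omega

/-- The sign change of the letter `e`. -/
def signChange {n : ℕ} (e : Letter n) : Perm (Letter n) := signedSwap (-e) e

theorem signChange_eq {n : ℕ} (e : Letter n) : signChange e = swap (-e) e := by
  simp [signChange, signedSwap]

theorem signChange_mul_self {n : ℕ} (e : Letter n) : signChange e * signChange e = 1 := by
  rw [signChange_eq, swap_mul_self]

theorem numNeg_signChange {n : ℕ} (e : Letter n) (he : 0 < (e : ℤ)) :
    numNeg (signChange e) = 1 := by
  rw [numNeg, Finset.card_eq_one]
  refine ⟨e, ?_⟩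
  ext x
  simp only [Finset.mem_filter, Finset.mem_univ, true_and, Finset.mem_singleton, signChange_eq]
  constructor
  · rintro ⟨h1, h2⟩
    by_contra hx
    rw [swap_apply_of_ne_of_ne (by rintro rfl; rw [coe_neg] at h1; omega) hx] at h2
    omega
  · rintro rfl
    rw [swap_apply_right, coe_neg]
    omega

theorem signChange_mem_level {n : ℕ} (e : Letter n) (he : (e : ℤ) = 1) :
    signChange e ∈ level n 1 := by
  refine ⟨signedSwap_mem _ _, fun x hx => ?_⟩
  refine signedSwap_apply_of_abs_lt _ _ _ ?_ ?_
  · rw [coe_neg, he]; simpa using hx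
  · rw [he]; simpa using hx

/-- An element of B_1 is determined by its value at the letter 1, which can only be 1 or -1. -/
theorem level_one_eq {n : ℕ} {σ : Perm (Letter n)} (e : Letter n) (he : (e : ℤ) = 1)
    (hσ : σ ∈ level n 1) : σ = 1 ∨ σ = signChange e := by
  have key : ∀ τ ∈ level n 1, τ e = e → τ = 1 := by
    intro τ hτ hτe
    ext1 x
    rw [Perm.one_apply]
    by_cases hx : (1 : ℤ) < |(x : ℤ)|
    · exact level_fix hτ x (by exact_mod_cast hx)
    · have h0 := abs_pos.mpr x.2.1
      rcases abs_choice (x : ℤ) with h | h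
      · rw [show x = e from Subtype.ext (by omega), hτe]
      · rw [show x = -e from Subtype.ext (by rw [coe_neg]; omega), level_neg hτ, hτe]
  have h1 := level_abs_le hσ e (by simp [he])
  have h0 := abs_pos.mpr (σ e).2.1
  rcases abs_choice (σ e : ℤ) with h | h
  · exact Or.inl (key σ hσ (Subtype.ext (by omega)))
  · right
    have h2 : σ e = -e := Subtype.ext (by rw [coe_neg]; omega)
    have h3 := key _ (mul_mem (signChange_mem_level e he) hσ) (by
      rw [Perm.mul_apply, h2, signChange_eq, swap_apply_left])
    rw [← one_mul σ, ← signChange_mul_self e, mul_assoc, h3, mul_one]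

/-! ### The generating function recursion along the chain. -/

/-- The weight `j - i - 2χ(i < 0)` of a signed transposition. -/
def swapWeight {n : ℕ} (i j : Letter n) : ℕ :=
  ((j : ℤ) - i - (if (i : ℤ) < 0 then 2 else 0)).toNat

/-- The positive letters x have the weights 0, …, m and the negative ones the weights m, …, 2m. The
exponent m occurs twice, which explains the separate term q^m t; the weight 0 belongs to x = m + 1
alone and carries no t. -/
theorem sum_pow_swapWeight {n : ℕ} {R : Type*} [CommRing R] (q t : R) (m : ℕ) (h : m < n) :
    ∑ x ∈ Finset.univ.filter (fun x : Letter n => |(x : ℤ)| ≤ m + 1),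
      q ^ swapWeight x (topLetter m h) * t ^ (if x = topLetter m h then 0 else 1)
      = 1 + q ^ m * t + q * t * qInt q (2 * m) := by
  classical
  rw [← Finset.sum_filter_add_sum_filter_not _ (fun x : Letter n => 0 < (x : ℤ))]
  have h1 : ∑ x ∈ (Finset.univ.filter (fun x : Letter n => |(x : ℤ)| ≤ m + 1)).filter
        (fun x : Letter n => 0 < (x : ℤ)),
      q ^ swapWeight x (topLetter m h) * t ^ (if x = topLetter m h then 0 else 1)
      = ∑ k ∈ Finset.range (m + 1), q ^ k * t ^ (if k = 0 then 0 else 1) := by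
    refine Finset.sum_bij' (fun x _ => swapWeight x (topLetter m h))
      (fun k hk => ⟨(m : ℤ) + 1 - k, ?_, ?_⟩) ?_ ?_ ?_ ?_ ?_
    · have := Finset.mem_range.mp hk; omega
    · have := Finset.mem_range.mp hk; rw [abs_le]; omega
    · intro x hx
      simp only [Finset.mem_filter, Finset.mem_univ, true_and, abs_le] at hx
      simp only [swapWeight, coe_topLetter, Finset.mem_range]
      omega
    · intro k hk
      have := Finset.mem_range.mp hk
      simp only [Finset.mem_filter, Finset.mem_univ, true_and, abs_le]
      omega
    · intro x hx
      simp only [Finset.mem_filter, Finset.mem_univ, true_and, abs_le] at hx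
      apply Subtype.ext
      simp only [swapWeight, coe_topLetter]
      rw [if_neg (by omega)]
      omega
    · intro k hk
      have := Finset.mem_range.mp hk
      simp only [swapWeight, coe_topLetter]
      rw [if_neg (by omega)]
      omega
    · intro x hx
      simp only [Finset.mem_filter, Finset.mem_univ, true_and, abs_le] at hx
      have : x = topLetter m h ↔ swapWeight x (topLetter m h) = 0 := by
        rw [Subtype.ext_iff, swapWeight, if_neg (by omega), coe_topLetter]
        omega
      simp only [this]
  have h2 : ∑ x ∈ (Finset.univ.filter (fun x : Letter n => |(x : ℤ)| ≤ m + 1)).filter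
        (fun x : Letter n => ¬ 0 < (x : ℤ)),
      q ^ swapWeight x (topLetter m h) * t ^ (if x = topLetter m h then 0 else 1)
      = ∑ k ∈ Finset.range (m + 1), q ^ (m + k) * t := by
    refine Finset.sum_bij' (fun x _ => swapWeight x (topLetter m h) - m)
      (fun k hk => ⟨-(k + 1 : ℤ), ?_, ?_⟩) ?_ ?_ ?_ ?_ ?_
    · omega
    · have := Finset.mem_range.mp hk; rw [abs_le]; omega
    · intro x hx
      simp only [Finset.mem_filter, Finset.mem_univ, true_and, abs_le] at hx
      simp only [swapWeight, coe_topLetter, Finset.mem_range]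
      omega
    · intro k hk
      have := Finset.mem_range.mp hk
      simp only [Finset.mem_filter, Finset.mem_univ, true_and, abs_le]
      omega
    · intro x hx
      have h0 := x.2.1
      simp only [Finset.mem_filter, Finset.mem_univ, true_and, abs_le] at hx
      apply Subtype.ext
      simp only [swapWeight, coe_topLetter]
      rw [if_pos (by omega)]
      omega
    · intro k hk
      have := Finset.mem_range.mp hk
      simp only [swapWeight, coe_topLetter]
      rw [if_pos (by omega)]
      omega
    · intro x hx
      have h0 := x.2.1
      simp only [Finset.mem_filter, Finset.mem_univ, true_and, abs_le] at hx
      have : x ≠ topLetter m h := by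
        rw [Ne, Subtype.ext_iff, coe_topLetter]
        omega
      rw [if_neg this, pow_one, swapWeight, if_pos (by omega), coe_topLetter]
      congr 2
      omega
  rw [h1, h2, Finset.sum_range_succ', Finset.sum_range_succ', qInt, two_mul, Finset.sum_range_add]
  simp only [Nat.add_eq_zero_iff, one_ne_zero, and_false, if_false, if_true, pow_zero, pow_one,
    mul_one, add_zero, mul_add, Finset.mul_sum]
  have h3 : ∀ k, q ^ (k + 1) * t = q * t * q ^ k := fun k => by ring
  have h4 : ∀ k, q ^ (m + (k + 1)) * t = q * t * q ^ (m + k) := fun k => by ring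
  simp only [h3, h4]
  ring

/-- A pair of statistics on `B_n` that grows in the prescribed way along coset representatives for
`B_1 ⊂ B_2 ⊂ ⋯ ⊂ B_n` has the product as its generating function over `D_n`. -/
theorem sum_typeD_eq_prod {n : ℕ} (hn : 1 ≤ n) (a b : Perm (Letter n) → ℕ)
    (h1 : ∀ σ ∈ level n 1, a σ = 0 ∧ b σ = 0)
    (hstep : ∀ (m : ℕ) (h : m < n), 1 ≤ m → ∀ x : Letter n, |(x : ℤ)| ≤ m + 1 →
      ∃ c ∈ level n (m + 1), c x = topLetter m h ∧ ∀ τ ∈ level n m,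
        a (τ * c) = a τ + swapWeight x (topLetter m h) ∧
        b (τ * c) = b τ + if x = topLetter m h then 0 else 1)
    {R : Type*} [CommRing R] (q t : R) :
    ∑ σ : typeD n, q ^ a (σ : Perm (Letter n)) * t ^ b (σ : Perm (Letter n))
      = ∏ r ∈ Finset.Icc 1 (n - 1), (1 + q ^ r * t + q * t * qInt q (2 * r)) := by
  classical
  -- The induction treats both parities at once, because a coset representative may be odd and thus
  -- exchange them.
  have main : ∀ m : ℕ, m + 1 ≤ n → ∀ ε : ℤ, (ε = 1 ∨ ε = -1) →
      ∑ σ ∈ Finset.univ.filter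
        (fun σ : Perm (Letter n) => σ ∈ level n (m + 1) ∧ (-1 : ℤ) ^ numNeg σ = ε),
        q ^ a σ * t ^ b σ
        = ∏ r ∈ Finset.Icc 1 m, (1 + q ^ r * t + q * t * qInt q (2 * r)) := by
    intro m
    induction m with
    | zero =>
      intro hm ε hε
      -- Each parity class of B_1 consists of one element.
      obtain ⟨g, hg, hg'⟩ : ∃ g : Perm (Letter n), Finset.univ.filter
          (fun σ : Perm (Letter n) => σ ∈ level n (0 + 1) ∧ (-1 : ℤ) ^ numNeg σ = ε) = {g} ∧
          g ∈ level n 1 := by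
        have he : ((topLetter 0 hn : Letter n) : ℤ) = 1 := by simp
        have hs := numNeg_signChange (topLetter 0 hn : Letter n) (by simp)
        have hs' := signChange_mem_level (topLetter 0 hn : Letter n) he
        rcases hε with rfl | rfl
        · refine ⟨1, ?_, one_mem _⟩
          ext σ
          simp only [Finset.mem_filter, Finset.mem_univ, true_and, Finset.mem_singleton, zero_add]
          constructor
          · rintro ⟨h2, h3⟩
            rcases level_one_eq _ he h2 with h4 | rfl
            · exact h4
            · rw [hs] at h3; norm_num at h3
          · rintro rfl
            exact ⟨one_mem _, by rw [numNeg_one, pow_zero]⟩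
        · refine ⟨_, ?_, hs'⟩
          ext σ
          simp only [Finset.mem_filter, Finset.mem_univ, true_and, Finset.mem_singleton, zero_add]
          constructor
          · rintro ⟨h2, h3⟩
            rcases level_one_eq _ he h2 with rfl | h4
            · rw [numNeg_one] at h3; norm_num at h3
            · exact h4
          · rintro rfl
            exact ⟨hs', by rw [hs, pow_one]⟩
      rw [hg, Finset.sum_singleton, (h1 g hg').1, (h1 g hg').2]
      simp
    | succ m ih =>
      intro hm ε hε
      have hstep' := hstep (m + 1) hm (by omega)
      choose! c hc1 hc2 hc3 using hstep'
      set M : Letter n := topLetter (m + 1) hm with hMdef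
      have hM : (M : ℤ) = m + 1 + 1 := by simp [hMdef]
      rw [Finset.prod_Icc_succ_top (by omega), ← sum_pow_swapWeight q t (m + 1) hm, Finset.mul_sum]
      -- The fibres of σ ↦ σ⁻¹(M) are the right cosets of the smaller group.
      rw [← Finset.sum_fiberwise_of_maps_to
        (t := Finset.univ.filter (fun x : Letter n => |(x : ℤ)| ≤ ((m + 1 : ℕ) : ℤ) + 1))
        (g := fun σ : Perm (Letter n) => σ⁻¹ M)]
      · refine Finset.sum_congr rfl fun x hx => ?_
        have hx' : |(x : ℤ)| ≤ ((m + 1 : ℕ) : ℤ) + 1 := (Finset.mem_filter.mp hx).2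
        have hcx := hc1 x hx'
        have hε' : ε * (-1) ^ numNeg (c x) = 1 ∨ ε * (-1) ^ numNeg (c x) = -1 := by
          rcases hε with rfl | rfl <;>
            rcases neg_one_pow_eq_or ℤ (numNeg (c x)) with h | h <;> simp [h]
        have hsq : ((-1 : ℤ) ^ numNeg (c x)) * (-1) ^ numNeg (c x) = 1 := by
          rw [← mul_pow]; norm_num
        -- If σ = τ c_x has sign ε, then τ has the sign ε · (-1)^N(c_x); the induction hypothesis
        -- gives the same product for either sign.
        rw [← ih (by omega) _ hε', Finset.sum_mul]
        symm
        refine Finset.sum_bij' (fun τ _ => τ * c x) (fun σ _ => σ * (c x)⁻¹) ?_ ?_ ?_ ?_ ?_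
        · intro τ hτ
          simp only [Finset.mem_filter, Finset.mem_univ, true_and] at hτ ⊢
          refine ⟨⟨mul_mem (level_mono (by omega) hτ.1) hcx, ?_⟩, ?_⟩
          · rw [neg_one_pow_numNeg_mul hτ.1.1 hcx.1, hτ.2, mul_assoc, hsq, mul_one]
          · rw [Perm.inv_eq_iff_eq, Perm.mul_apply, hc2 x hx', level_fix hτ.1]
            rw [hM, abs_of_pos (by omega)]
            push_cast
            omega
        · intro σ hσ
          simp only [Finset.mem_filter, Finset.mem_univ, true_and] at hσ ⊢
          obtain ⟨⟨hσ1, hσ2⟩, hσ3⟩ := hσ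
          have hmem := mul_mem hσ1 (inv_mem hcx)
          refine ⟨⟨hmem.1, fun y hy => ?_⟩, ?_⟩
          · by_cases hyM : y = M
            · rw [hyM, Perm.mul_apply, Perm.inv_eq_iff_eq.mpr (hc2 x hx').symm,
                Perm.inv_eq_iff_eq.mp hσ3]
            · refine hmem.2 y ?_
              have : (y : ℤ) ≠ M := fun h => hyM (Subtype.ext h)
              push_cast at hy ⊢
              omega
          · have h5 := neg_one_pow_numNeg_mul hmem.1 hcx.1
            rw [inv_mul_cancel_right, hσ2] at h5
            rw [h5, mul_assoc, hsq, mul_one]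
        · intro τ _
          simp
        · intro σ _
          simp
        · intro τ hτ
          have h6 := hc3 x hx' τ (Finset.mem_filter.mp hτ).2.1
          rw [h6.1, h6.2, pow_add, pow_add]
          ring
      · intro σ hσ
        simp only [Finset.mem_filter, Finset.mem_univ, true_and] at hσ ⊢
        have := level_abs_le (inv_mem hσ.1) M (by rw [hM, abs_of_pos (by omega)]; push_cast; omega)
        exact_mod_cast this
  have h2 := main (n - 1) (by omega) 1 (Or.inl rfl)
  rw [← h2, ← Finset.sum_coe_sort (Finset.univ.filter _)]
  refine Fintype.sum_equiv (Equiv.subtypeEquivRight fun σ => ?_) _ _ fun σ => rfl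
  rw [Finset.mem_filter, Nat.sub_add_cancel hn, level_self,
    neg_one_pow_eq_one_iff_even (by norm_num)]
  simp [typeD]

/-! ### Codimension of the fixed space in the reflection representation. -/

/-- The odd functions on the letters that are invariant under `σ`. -/
def fixedOdd {n : ℕ} (σ : Perm (Letter n)) : Submodule ℚ (Letter n → ℚ) where
  carrier := {v | (∀ x, v (-x) = -v x) ∧ ∀ x, v (σ x) = v x}
  add_mem' := by
    rintro v w ⟨h1, h2⟩ ⟨h3, h4⟩
    exact ⟨fun x => by simp [h1, h3, add_comm], fun x => by simp [h2, h4]⟩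
  zero_mem' := ⟨fun x => by simp, fun x => rfl⟩
  smul_mem' := by
    rintro c v ⟨h1, h2⟩
    exact ⟨fun x => by simp [h1], fun x => by simp [h2]⟩

/-- The codimension of the fixed space in the reflection representation. -/
noncomputable def codimFix {n : ℕ} (σ : Perm (Letter n)) : ℕ :=
  Module.finrank ℚ (fixedOdd (1 : Perm (Letter n))) - Module.finrank ℚ (fixedOdd σ)

/-- The functional `v ↦ v i - v j`, whose kernel is the hyperplane of a signed transposition. -/
def diffFunctional {n : ℕ} (i j : Letter n) : (Letter n → ℚ) →ₗ[ℚ] ℚ :=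
  LinearMap.proj (R := ℚ) (φ := fun _ : Letter n => ℚ) i - LinearMap.proj j

theorem mem_ker_diffFunctional {n : ℕ} {i j : Letter n} {v : Letter n → ℚ} :
    v ∈ LinearMap.ker (diffFunctional i j) ↔ v i = v j := by
  simp [diffFunctional, sub_eq_zero]

theorem finrank_le_finrank_inf_ker_add_one {V : Type*} [AddCommGroup V] [Module ℚ V]
    [FiniteDimensional ℚ V] (W : Submodule ℚ V) (φ : V →ₗ[ℚ] ℚ) :
    Module.finrank ℚ W ≤ Module.finrank ℚ (W ⊓ LinearMap.ker φ : Submodule ℚ V) + 1 := by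
  have h1 := LinearMap.finrank_range_add_finrank_ker (φ.domRestrict W)
  have h2 : Module.finrank ℚ (LinearMap.range (φ.domRestrict W)) ≤ 1 := by
    simpa using Submodule.finrank_le (LinearMap.range (φ.domRestrict W))
  have h3 : Module.finrank ℚ (LinearMap.ker (φ.domRestrict W))
      = Module.finrank ℚ (W ⊓ LinearMap.ker φ : Submodule ℚ V) := by
    rw [LinearMap.ker_domRestrict, ← Submodule.map_comap_subtype]
    exact (Submodule.finrank_map_subtype_eq _ _).symm
  omega

theorem finrank_inf_ker_lt {V : Type*} [AddCommGroup V] [Module ℚ V]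
    [FiniteDimensional ℚ V] (W : Submodule ℚ V) (φ : V →ₗ[ℚ] ℚ) (v : V) (hv : v ∈ W)
    (hφ : φ v ≠ 0) :
    Module.finrank ℚ (W ⊓ LinearMap.ker φ : Submodule ℚ V) < Module.finrank ℚ W := by
  refine Submodule.finrank_lt_finrank_of_lt (lt_of_le_of_ne inf_le_left fun h => hφ ?_)
  rw [← h] at hv
  exact hv.2

theorem signedSwap_invariant {n : ℕ} {i j : Letter n} {v : Letter n → ℚ}
    (hv : ∀ x, v (-x) = -v x) (h : v i = v j) (x : Letter n) : v (signedSwap i j x) = v x := by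
  have key : ∀ a b y : Letter n, v a = v b → v (swap a b y) = v y := by
    intro a b y hab
    rw [swap_apply_def]
    split_ifs with h1 h2
    · rw [h1, hab]
    · rw [h2, hab]
    · rfl
  unfold signedSwap
  split_ifs
  · exact key _ _ _ h
  · rw [Perm.mul_apply, key _ _ _ h, key _ _ _ (by rw [hv, hv, h])]

theorem finrank_fixedOdd_le {n : ℕ} (σ : Perm (Letter n)) :
    Module.finrank ℚ (fixedOdd σ) ≤ Module.finrank ℚ (fixedOdd (1 : Perm (Letter n))) :=
  Submodule.finrank_mono fun _ hv => ⟨hv.1, fun _ => rfl⟩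

theorem codimFix_one {n : ℕ} : codimFix (1 : Perm (Letter n)) = 0 := by simp [codimFix]

/-- A vector fixed by σ and lying on the hyperplane of the reflection is fixed by the product, and a
hyperplane section lowers the dimension by at most one. -/
theorem codimFix_signedSwap_mul_le {n : ℕ} (i j : Letter n) (σ : Perm (Letter n)) :
    codimFix (signedSwap i j * σ) ≤ codimFix σ + 1 := by
  have h1 := finrank_le_finrank_inf_ker_add_one (fixedOdd σ) (diffFunctional i j)
  have h2 : Module.finrank ℚ (fixedOdd σ ⊓ LinearMap.ker (diffFunctional i j) : Submodule ℚ _)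
      ≤ Module.finrank ℚ (fixedOdd (signedSwap i j * σ)) := by
    refine Submodule.finrank_mono fun v hv => ⟨hv.1.1, fun x => ?_⟩
    rw [Perm.mul_apply, signedSwap_invariant hv.1.1 (mem_ker_diffFunctional.mp hv.2), hv.1.2]
  have := finrank_fixedOdd_le σ
  unfold codimFix
  omega

/-- Here the fixed space is exactly that of τ cut by the hyperplane v x = v M, since τ fixes M and
the product sends x to M. The cut is proper because the coordinate vector of M is fixed by τ and
lies off the hyperplane. -/
theorem codimFix_mul_signedSwap {n m : ℕ} (h : m < n) {τ : Perm (Letter n)} (hτ : τ ∈ level n m)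
    (x : Letter n) (hx : x ≠ topLetter m h) :
    codimFix (τ * signedSwap x (topLetter m h)) = codimFix τ + 1 := by
  set M : Letter n := topLetter m h with hMdef
  have hM : (M : ℤ) = m + 1 := by simp [hMdef]
  have hτM : τ M = M := hτ.2 M (by omega)
  have h1 : fixedOdd (τ * signedSwap x M)
      = fixedOdd τ ⊓ LinearMap.ker (diffFunctional x M) := by
    ext v
    constructor
    · rintro ⟨hv1, hv2⟩
      have h3 : v x = v M := by
        rw [← hv2 x, Perm.mul_apply, signedSwap_apply_left, hτM]
      refine ⟨⟨hv1, fun y => ?_⟩, mem_ker_diffFunctional.mpr h3⟩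
      have h4 := hv2 ((signedSwap x M)⁻¹ y)
      have h5 : signedSwap x M ((signedSwap x M)⁻¹ y) = y := by simp
      rw [Perm.mul_apply, h5] at h4
      rw [h4, ← signedSwap_invariant hv1 h3, h5]
    · rintro ⟨⟨hv1, hv2⟩, hv3⟩
      refine ⟨hv1, fun y => ?_⟩
      rw [Perm.mul_apply, hv2, signedSwap_invariant hv1 (mem_ker_diffFunctional.mp hv3)]
  have h2 := finrank_le_finrank_inf_ker_add_one (fixedOdd τ) (diffFunctional x M)
  -- The coordinate vector of M as an odd function; its value at x ≠ M is 0 or -1, never 1.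
  let v : Letter n → ℚ := fun y => if y = M then 1 else if y = -M then -1 else 0
  have hv : v ∈ fixedOdd τ := by
    refine ⟨fun y => ?_, fun y => ?_⟩
    · have hne := M.neg_ne
      simp only [v, neg_eq_iff_eq_neg, neg_neg]
      by_cases h1 : y = M
      · subst h1; simp [hne.symm]
      · by_cases h2 : y = -M
        · subst h2; simp [hne]
        · simp [h1, h2]
    · have h5 : τ y = M ↔ y = M := by rw [← τ.injective.eq_iff (a := y), hτM]
      have h6 : τ y = -M ↔ y = -M := by
        rw [← τ.injective.eq_iff (a := y), level_neg hτ, hτM]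
      simp only [v, h5, h6]
  have h3 := finrank_inf_ker_lt (fixedOdd τ) (diffFunctional x M) v hv (by
    rw [Ne, ← LinearMap.mem_ker, mem_ker_diffFunctional]
    simp only [v, if_neg hx, if_true]
    split_ifs <;> norm_num)
  have h4 := finrank_fixedOdd_le τ
  unfold codimFix
  rw [h1]
  omega

/-! ### Reflection length with respect to T^D. -/

/-- The reflection length of `B_n` modulo the sign change of the letter `e`. -/
noncomputable def reducedLength {n : ℕ} (e : Letter n) (σ : Perm (Letter n)) : ℕ :=
  min (codimFix σ) (codimFix (signChange e * σ))

theorem reducedLength_of_mem_level_one {n : ℕ} {e : Letter n} (he : (e : ℤ) = 1)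
    {σ : Perm (Letter n)} (hσ : σ ∈ level n 1) : reducedLength e σ = 0 := by
  rcases level_one_eq e he hσ with rfl | rfl
  · simp [reducedLength, codimFix_one]
  · simp [reducedLength, signChange_mul_self, codimFix_one]

/-- As m ≥ 1, the sign change of 1 lies in B_m, so both terms of the minimum grow by one. -/
theorem reducedLength_mul {n m : ℕ} {e : Letter n} (he : (e : ℤ) = 1) (h : m < n) (hm : 1 ≤ m)
    {τ : Perm (Letter n)} (hτ : τ ∈ level n m) (x : Letter n) (hx : x ≠ topLetter m h) :
    reducedLength e (τ * signedSwap x (topLetter m h)) = reducedLength e τ + 1 := by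
  have hs : signChange e * τ ∈ level n m :=
    mul_mem (level_mono hm (signChange_mem_level e he)) hτ
  rw [reducedLength, ← mul_assoc, codimFix_mul_signedSwap h hτ x hx,
    codimFix_mul_signedSwap h hs x hx, reducedLength]
  omega

theorem signedSwap_conj {n : ℕ} {g : Perm (Letter n)} (hg : g ∈ hyperoctahedral n)
    (i j : Letter n) : g * signedSwap i j * g⁻¹ = signedSwap (g i) (g j) := by
  have hg' : ∀ x, g (-x) = -g x := hg
  have h : g i = -g j ↔ i = -j := by rw [← hg', g.injective.eq_iff]
  unfold signedSwap
  simp only [h]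
  split_ifs
  · rw [← swap_apply_apply]
  · rw [← hg', ← hg', swap_apply_apply, swap_apply_apply]
    group

theorem signChange_apply {n : ℕ} {e : Letter n} (x : Letter n) (h1 : x ≠ e) (h2 : x ≠ -e) :
    signChange e x = x := by
  rw [signChange_eq, swap_apply_of_ne_of_ne h2 h1]

theorem abs_signChange {n : ℕ} (e x : Letter n) : |(signChange e x : ℤ)| = |(x : ℤ)| := by
  by_cases h1 : x = e
  · rw [h1, signChange_eq, swap_apply_right, coe_neg, abs_neg]
  · by_cases h2 : x = -e
    · rw [h2, signChange_eq, swap_apply_left, coe_neg, abs_neg]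
    · rw [signChange_apply x h1 h2]

theorem signChange_conj {n : ℕ} (e i j : Letter n) :
    signChange e * signedSwap i j = signedSwap (signChange e i) (signChange e j) * signChange e := by
  rw [← signedSwap_conj (g := signChange e) (signedSwap_mem _ _) i j, inv_mul_cancel_right]

theorem signChange_comm {n : ℕ} {e i : Letter n} (he : (e : ℤ) = 1) (hi : 1 < (i : ℤ)) :
    signChange e * signChange i = signChange i * signChange e := by
  have h1 : i ≠ e := by rintro rfl; omega
  have h2 : i ≠ -e := by rintro rfl; rw [coe_neg] at hi; omega
  have h3 : signChange e i = i := signChange_apply i h1 h2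
  have h4 : signChange e (-i) = -i := by
    rw [show signChange e (-i) = -signChange e i from signedSwap_mem _ _ _, h3]
  conv_lhs => rw [signChange.eq_1 i, signChange_conj, h3, h4]
  rfl

/-- Let s be the sign change of 1. For g = (i, j), moving s past g replaces g by a conjugate signed
transposition, so each term of the minimum grows by at most one. For g = (-i, i)(-1, 1), the factor
s in g interchanges the two terms, and (-i, i) again costs at most one. -/
theorem reducedLength_refl_mul_le {n : ℕ} {e : Letter n} (he : (e : ℤ) = 1)
    {g : Perm (Letter n)} (hg : g ∈ reflD n) (σ : Perm (Letter n)) :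
    reducedLength e (g * σ) ≤ reducedLength e σ + 1 := by
  unfold reducedLength
  rcases hg with ⟨i, j, -, rfl⟩ | ⟨i, e', he', hi, rfl⟩
  · have h1 := codimFix_signedSwap_mul_le i j σ
    have h2 := codimFix_signedSwap_mul_le (signChange e i) (signChange e j) (signChange e * σ)
    rw [← mul_assoc, ← signChange_conj, mul_assoc] at h2
    omega
  · obtain rfl : e' = e := Subtype.ext (by omega)
    have h1 := codimFix_signedSwap_mul_le (-i) i σ
    have h2 := codimFix_signedSwap_mul_le (-i) i (signChange e' * σ)
    have h3 : signChange e' * (signedSwap (-i) i * signedSwap (-e') e' * σ)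
        = signedSwap (-i) i * σ := by
      change signChange e' * (signChange i * signChange e' * σ) = signChange i * σ
      rw [← signChange_comm he hi, ← mul_assoc, ← mul_assoc, signChange_mul_self, one_mul]
    have h4 : signedSwap (-i) i * signedSwap (-e') e' * σ
        = signedSwap (-i) i * (signChange e' * σ) := mul_assoc _ _ _
    rw [h3, h4]
    omega

theorem reducedLength_prod_le {n : ℕ} {e : Letter n} (he : (e : ℤ) = 1)
    (L : List (Perm (Letter n))) (hL : ∀ g ∈ L, g ∈ reflD n) :
    reducedLength e L.prod ≤ L.length := by
  induction L with
  | nil => simp [reducedLength_of_mem_level_one he (one_mem _)]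
  | cons g L ih =>
    rw [List.prod_cons, List.length_cons]
    have h1 := reducedLength_refl_mul_le he (hL g (by simp)) L.prod
    have h2 := ih fun g hg => hL g (by simp [hg])
    omega

theorem signedSwap_apply {n : ℕ} {i j : Letter n} (hij : |(i : ℤ)| < j) (x : Letter n) :
    signedSwap i j x = if x = i then j else if x = j then i else if x = -i then -j
      else if x = -j then -i else x := by
  have h := abs_lt.mp hij
  have ne1 : i ≠ j := by rintro rfl; omega
  have ne2 : i ≠ -j := by rintro rfl; rw [coe_neg] at h; omega
  have ne3 : j ≠ -j := j.neg_ne.symm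
  have ne4 : i ≠ -i := i.neg_ne.symm
  have ne5 : j ≠ -i := fun h => ne2 (by rw [h, neg_neg])
  have hn : ∀ y, signedSwap i j (-y) = -signedSwap i j y := signedSwap_mem i j
  have h1 : signedSwap i j i = j := signedSwap_apply_left i j
  have h2 : signedSwap i j j = i := by
    rw [signedSwap, if_neg ne2, Perm.mul_apply, swap_apply_of_ne_of_ne ne5 ne3, swap_apply_right]
  split_ifs with a1 a2 a3 a4
  · rw [a1, h1]
  · rw [a2, h2]
  · rw [a3, hn, h1]
  · rw [a4, hn, h2]
  · rw [signedSwap, if_neg ne2, Perm.mul_apply, swap_apply_of_ne_of_ne a3 a4,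
      swap_apply_of_ne_of_ne a1 a2]

/-- For i > 0 the word has no minus sign; for i < 0 it has exactly two, at the positions -i and j.
-/
theorem even_numNeg_signedSwap {n : ℕ} {i j : Letter n} (hij : |(i : ℤ)| < j) :
    Even (numNeg (signedSwap i j)) := by
  have h := abs_lt.mp hij
  have hi := i.2.1
  rcases lt_or_gt_of_ne hi with h0 | h0
  · have : (Finset.univ.filter fun x : Letter n => 0 < (x : ℤ) ∧ (signedSwap i j x : ℤ) < 0)
        = {-i, j} := by
      ext x
      simp only [Finset.mem_filter, Finset.mem_univ, true_and, Finset.mem_insert,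
        Finset.mem_singleton, signedSwap_apply hij]
      split_ifs with a1 a2 a3 a4
      · subst a1; simp only [Subtype.ext_iff, coe_neg]; omega
      · subst a2; simp only [Subtype.ext_iff, coe_neg, or_true, iff_true]; omega
      · subst a3; simp only [Subtype.ext_iff, coe_neg, true_or, iff_true]; omega
      · subst a4; simp only [Subtype.ext_iff, coe_neg]; omega
      · simp only [a2, a3, or_self, iff_false]; omega
    rw [numNeg, this, Finset.card_pair (by simp only [ne_eq, Subtype.ext_iff, coe_neg]; omega)]
    decide
  · have : numNeg (signedSwap i j) = 0 := by
      rw [numNeg, Finset.card_eq_zero, Finset.filter_eq_empty_iff]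
      intro x _
      rw [signedSwap_apply hij]
      split_ifs with a1 a2 a3 a4
      · omega
      · omega
      · subst a3; simp only [coe_neg]; omega
      · subst a4; simp only [coe_neg]; omega
      · omega
    rw [this]
    exact Even.zero

theorem reflD_le_typeD {n : ℕ} {g : Perm (Letter n)} (hg : g ∈ reflD n) : g ∈ typeD n := by
  rcases hg with ⟨i, j, hij, rfl⟩ | ⟨i, e, he, hi, rfl⟩
  · exact ⟨signedSwap_mem i j, even_numNeg_signedSwap hij⟩
  · refine ⟨mul_mem (signedSwap_mem _ _) (signedSwap_mem _ _), ?_⟩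
    have h := neg_one_pow_numNeg_mul (signedSwap_mem (-i) i) (signedSwap_mem (-e) e)
    have h1 : numNeg (signedSwap (-i) i) = 1 := numNeg_signChange i (by omega)
    have h2 : numNeg (signedSwap (-e) e) = 1 := numNeg_signChange e (by omega)
    rw [h1, h2, pow_one] at h
    exact (neg_one_pow_eq_one_iff_even (by norm_num)).mp (h.trans (by norm_num))

/-- Peeling off the signed transposition that moves M into place lowers the reduced length by one.
Elements of T^D are even, so an odd σ is reached only up to the sign change of 1; carrying this
ambiguity lets the induction run over all of B_m. -/
theorem exists_reflD_factorization {n : ℕ} {e : Letter n} (he : (e : ℤ) = 1) (m : ℕ) (hm : 1 ≤ m)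
    (hmn : m ≤ n) : ∀ σ ∈ level n m, ∃ L : List (Perm (Letter n)),
      L.length = reducedLength e σ ∧ (∀ g ∈ L, g ∈ reflD n) ∧
        (L.prod = σ ∨ L.prod = σ * signChange e) := by
  induction m, hm using Nat.le_induction with
  | base =>
    intro σ hσ
    refine ⟨[], by simp [reducedLength_of_mem_level_one he hσ], by simp, ?_⟩
    rcases level_one_eq e he hσ with rfl | rfl
    · simp
    · simp [signChange_mul_self]
  | succ m hm ih =>
    intro σ hσ
    set M : Letter n := topLetter m hmn with hMdef
    have hM : (M : ℤ) = m + 1 := by simp [hMdef]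
    obtain ⟨x, hx⟩ : ∃ x, x = σ⁻¹ M := ⟨_, rfl⟩
    have hσx : σ x = M := by simp [hx]
    have hxM : |(x : ℤ)| ≤ m + 1 := by
      have := level_abs_le (inv_mem hσ) M (by rw [hM, abs_of_pos (by omega)]; push_cast; omega)
      rw [hx]
      exact_mod_cast this
    -- An element of B_{m+1} that fixes M already lies in B_m.
    have down : ∀ g ∈ level n (m + 1), g M = M → g ∈ level n m := by
      refine fun g hg hgM => ⟨hg.1, fun y hy => ?_⟩
      by_cases hyM : y = M
      · rw [hyM, hgM]
      · refine hg.2 y ?_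
        have : (y : ℤ) ≠ M := fun h => hyM (Subtype.ext h)
        push_cast
        omega
    by_cases hxeq : x = M
    · exact ih (by omega) σ (down σ hσ (by rwa [hxeq] at hσx))
    have hsw : signedSwap x M ∈ level n (m + 1) := by
      refine ⟨signedSwap_mem _ _, fun y hy => signedSwap_apply_of_abs_lt _ _ _ ?_ ?_⟩
      · push_cast at hy; omega
      · rw [hM, abs_of_pos (by omega)]; push_cast at hy; omega
    obtain ⟨τ, hτdef⟩ : ∃ τ, τ = σ * (signedSwap x M)⁻¹ := ⟨_, rfl⟩
    have hτ : τ ∈ level n m := by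
      rw [hτdef]
      refine down _ (mul_mem hσ (inv_mem hsw)) ?_
      rw [Perm.mul_apply, Perm.inv_eq_iff_eq.mpr (signedSwap_apply_left x M).symm, hσx]
    have hστ : σ = τ * signedSwap x M := by simp [hτdef]
    obtain ⟨L, hL1, hL2, hL3⟩ := ih (by omega) τ hτ
    have hlen : reducedLength e σ = reducedLength e τ + 1 := by
      rw [hστ, reducedLength_mul he hmn hm hτ x hxeq]
    have app : ∀ g ∈ reflD n, (L.prod * g = σ ∨ L.prod * g = σ * signChange e) →
        ∃ L : List (Perm (Letter n)), L.length = reducedLength e σ ∧ (∀ g ∈ L, g ∈ reflD n) ∧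
        (L.prod = σ ∨ L.prod = σ * signChange e) := by
      intro g hg h
      refine ⟨L ++ [g], by simp [hL1, hlen], ?_, by simpa using h⟩
      intro g' hg'
      rcases List.mem_append.mp hg' with h' | h'
      · exact hL2 g' h'
      · rw [List.mem_singleton.mp h']; exact hg
    have heM : signChange e M = M := signChange_apply M (by rintro h; rw [h] at hM; omega)
      (by rintro h; rw [h, coe_neg] at hM; omega)
    -- The sign change of M is odd and not in T^D; multiplied by the sign change of 1 it is, and
    -- this switches between the two alternatives for the product.
    by_cases hneg : x = -M
    · have hg : signChange M * signChange e ∈ reflD n :=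
        Or.inr ⟨M, e, he, by omega, rfl⟩
      have hσ' : σ = τ * signChange M := by rw [hστ, hneg]; rfl
      refine app _ hg ?_
      rcases hL3 with h | h
      · right; rw [h, hσ', ← mul_assoc]
      · left
        rw [h, hσ', ← signChange_comm he (by omega), mul_assoc, ← mul_assoc (signChange e),
          signChange_mul_self, one_mul]
    · have hlt : |(x : ℤ)| < M := by
        rw [hM]
        refine lt_of_le_of_ne hxM fun h => ?_
        rcases abs_choice (x : ℤ) with h' | h'
        · exact hxeq (Subtype.ext (by omega))
        · exact hneg (Subtype.ext (by rw [coe_neg]; omega))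
      rcases hL3 with h | h
      · exact app _ (Or.inl ⟨x, M, hlt, rfl⟩) (Or.inl (by rw [h, hστ]))
      -- The surplus sign change of 1 is moved to the right end, which conjugates the transposition;
      -- hence the conjugate is the one to append.
      · refine app (signedSwap (signChange e x) M)
          (Or.inl ⟨_, M, by rwa [abs_signChange], rfl⟩) (Or.inr ?_)
        have h5 := signChange_conj e (signChange e x) M
        have h6 : signChange e (signChange e x) = x := by
          rw [← Perm.mul_apply, signChange_mul_self, Perm.one_apply]
        rw [heM, h6] at h5
        rw [h, hστ, mul_assoc, h5, mul_assoc]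

/-- The upper bound comes from the factorization up to a sign change, whose second alternative is
excluded by parity on D_n. The lower bound holds because each factor in T^D raises the reduced
length by at most one. -/
theorem reflLenD_eq_reducedLength {n : ℕ} {e : Letter n} (he : (e : ℤ) = 1) (hn : 1 ≤ n)
    (σ : typeD n) : reflLenD σ = reducedLength e σ := by
  obtain ⟨L, hL1, hL2, hL3⟩ := exists_reflD_factorization he n hn le_rfl σ
    (by rw [level_self]; exact σ.2.1)
  have hmem : L.prod ∈ typeD n := Subgroup.list_prod_mem _ fun g hg => reflD_le_typeD (hL2 g hg)
  have hL4 : L.prod = σ := by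
    rcases hL3 with h | h
    · exact h
    · exfalso
      rw [h] at hmem
      have h1 := (Subgroup.mul_mem_cancel_left (typeD n) σ.2).mp hmem
      have h2 := h1.2
      rw [numNeg_signChange e (by omega)] at h2
      exact absurd h2 (by decide)
  refine le_antisymm (hL1 ▸ Nat.sInf_le ⟨L, rfl, hL2, hL4⟩) ?_
  refine le_csInf ⟨_, L, rfl, hL2, hL4⟩ ?_
  rintro k ⟨L', rfl, h2, h3⟩
  rw [← h3]
  exact reducedLength_prod_le he L' h2

/-! ### The sorting index and the second product formula. -/

open Classical in
/-- The weight of the factorization of `σ`, as a function on all permutations. -/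
noncomputable def sortIndex {n : ℕ} (σ : Perm (Letter n)) : ℕ :=
  if h : ∃ L, IsSortFactorization σ L then sortWeight h.choose else 0

theorem sortIndex_eq {n : ℕ} {σ : Perm (Letter n)} (hσ : σ ∈ hyperoctahedral n)
    {L : List (Letter n × Letter n)} (hL : IsSortFactorization σ L) :
    sortIndex σ = sortWeight L := by
  have h : ∃ L, IsSortFactorization σ L := ⟨L, hL⟩
  rw [sortIndex, dif_pos h, (existsUnique_sortFactorization hσ).unique h.choose_spec hL]

theorem sorD_eq_sortIndex {n : ℕ} (σ : typeD n) : sorD σ = sortIndex (σ : Perm (Letter n)) :=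
  (sortIndex_eq σ.2.1 (existsUnique_sortFactorization σ.2.1).choose_spec.1).symm

theorem sortIndex_of_mem_level_one {n : ℕ} {e : Letter n} (he : (e : ℤ) = 1)
    {σ : Perm (Letter n)} (hσ : σ ∈ level n 1) : sortIndex σ = 0 := by
  rcases level_one_eq e he hσ with rfl | rfl
  · rw [sortIndex_eq hσ.1 (L := []) ⟨by simp, by simp, by simp⟩]
    rfl
  -- The pair (-1, 1) has weight 1 + 1 - 2 = 0.
  · rw [sortIndex_eq hσ.1 (L := [(-e, e)]) ⟨by simp [he, e.neg_ne], by simp, by simp [signChange]⟩]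
    simp [sortWeight, he]

/-- The factorization of τ uses second entries at most m, so appending (x, m + 1) keeps them
increasing; by uniqueness the result is the factorization of the product. -/
theorem sortIndex_mul {n m : ℕ} (h : m < n) {τ : Perm (Letter n)} (hτ : τ ∈ level n m)
    (x : Letter n) (hx : x ≠ topLetter m h) (hx' : |(x : ℤ)| ≤ m + 1) :
    sortIndex (τ * signedSwap x (topLetter m h)) = sortIndex τ + swapWeight x (topLetter m h) := by
  obtain ⟨L, ⟨hL, hL'⟩, -⟩ := existsUnique_sortFactorization_aux m τ hτ.1 hτ.2
  rw [sortIndex_eq hτ.1 hL, sortIndex_eq (mul_mem hτ.1 (signedSwap_mem _ _))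
    (L := L ++ [(x, topLetter m h)])]
  · simp [sortWeight, swapWeight]
  · refine ⟨?_, ?_, by simp [hL.2.2]⟩
    · intro p hp
      rcases List.mem_append.mp hp with h' | h'
      · exact hL.1 p h'
      · rw [List.mem_singleton.mp h']
        exact ⟨by simp only [coe_topLetter]; omega, by simpa using hx', hx⟩
    · rw [List.map_append, List.pairwise_append]
      refine ⟨hL.2.1, by simp, ?_⟩
      intro a ha b hb
      obtain ⟨p, hp, rfl⟩ := List.mem_map.mp ha
      have hb : b = topLetter m h := by simpa using hb
      have := hL' p hp
      rw [hb, ← Subtype.coe_lt_coe, coe_topLetter]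
      omega

theorem sum_sorD_reflLenD {n : ℕ} (hn : 1 ≤ n) {R : Type*} [CommRing R] (q t : R) :
    ∑ σ : typeD n, q ^ sorD σ * t ^ reflLenD σ
      = ∏ r ∈ Finset.Icc 1 (n - 1), (1 + q ^ r * t + q * t * qInt q (2 * r)) := by
  have he : ((topLetter 0 hn : Letter n) : ℤ) = 1 := by simp
  simp only [sorD_eq_sortIndex, reflLenD_eq_reducedLength he hn]
  refine sum_typeD_eq_prod hn sortIndex (reducedLength (topLetter 0 hn)) ?_ ?_ q t
  · exact fun σ hσ => ⟨sortIndex_of_mem_level_one he hσ, reducedLength_of_mem_level_one he hσ⟩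
  · intro m h hm x hx
    by_cases hxM : x = topLetter m h
    · refine ⟨1, one_mem _, by rw [hxM, Perm.one_apply], fun τ _ => ?_⟩
      rw [mul_one, if_pos hxM, hxM, swapWeight, if_neg (by rw [coe_topLetter]; omega)]
      simp
    · refine ⟨signedSwap x (topLetter m h), ⟨signedSwap_mem _ _, fun y hy => ?_⟩,
        signedSwap_apply_left _ _, fun τ hτ => ?_⟩
      · push_cast at hy
        refine signedSwap_apply_of_abs_lt _ _ _ (by omega) ?_
        rw [coe_topLetter, abs_of_pos (by omega)]
        omega
      · rw [sortIndex_mul h hτ x hxM hx, reducedLength_mul he h hm hτ x hxM, if_neg hxM]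
        exact ⟨rfl, rfl⟩

/-! ### Insertion of a letter, and counting of positions and pairs. -/

/-- The position `p` is sent to the letter `M` up to sign, and the other positive positions to the
other positive letters in an order preserving way. -/
structure IsInsertion {n : ℕ} (c : Perm (Letter n)) (p M : Letter n) : Prop where
  pos : 0 < (p : ℤ)
  pos' : 0 < (M : ℤ)
  mem_iff : ∀ i, (0 < (c i : ℤ) ∧ c i ≠ M) ↔ (0 < (i : ℤ) ∧ i ≠ p)
  lt_iff : ∀ i j : Letter n, 0 < (i : ℤ) → i ≠ p → 0 < (j : ℤ) → j ≠ p →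
    ((c i : ℤ) < c j ↔ (i : ℤ) < j)

/-- The number of pairs of positions `i < j` that are related by `Q`. -/
noncomputable def pairCount {n : ℕ} (Q : Letter n → Letter n → Prop) : ℕ :=
  {k : Letter n × Letter n | 0 < (k.1 : ℤ) ∧ (k.1 : ℤ) < k.2 ∧ Q k.1 k.2}.ncard

/-- The number of positions `i` that satisfy `Q`. -/
noncomputable def posCount {n : ℕ} (Q : Letter n → Prop) : ℕ :=
  {i : Letter n | 0 < (i : ℤ) ∧ Q i}.ncard

theorem posCount_eq_zero {n : ℕ} {Q : Letter n → Prop}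
    (h : ∀ i : Letter n, 0 < (i : ℤ) → ¬ Q i) : posCount Q = 0 := by
  rw [posCount, Set.ncard_eq_zero, Set.eq_empty_iff_forall_notMem]
  exact fun i hi => h i hi.1 hi.2

theorem posCount_congr {n : ℕ} {Q Q' : Letter n → Prop}
    (h : ∀ i : Letter n, 0 < (i : ℤ) → (Q i ↔ Q' i)) : posCount Q = posCount Q' := by
  unfold posCount
  congr 1
  ext i
  exact and_congr_right (h i)

theorem posCount_interval {n a b : ℕ} (hb : b ≤ n) :
    posCount (fun i : Letter n => (a : ℤ) < i ∧ (i : ℤ) ≤ b) = b - a := by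
  rw [← Nat.card_Ioc a b, ← Set.ncard_coe_finset, posCount]
  refine Set.ncard_congr (fun i _ => (i : ℤ).toNat) ?_ ?_ ?_
  · rintro i ⟨h1, h2, h3⟩
    rw [Finset.mem_coe, Finset.mem_Ioc]
    omega
  · rintro i j ⟨h1, -⟩ ⟨h2, -⟩ h3
    exact Subtype.ext (by omega)
  · intro k hk
    have := Finset.mem_Ioc.mp hk
    exact ⟨⟨k, by omega, by rw [abs_le]; omega⟩, ⟨by simp only; omega, by simp only; omega⟩,
      by simp⟩

theorem posCount_split {n : ℕ} (Q : Letter n → Prop) (p : Letter n) :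
    posCount Q = posCount (fun i => i ≠ p ∧ Q i) + posCount (fun i => i = p ∧ Q i) := by
  unfold posCount
  rw [← Set.ncard_union_eq]
  · congr 1
    ext i
    simp only [Set.mem_ofPred_eq, Set.mem_union]
    tauto
  · rw [Set.disjoint_left]
    exact fun i h h' => h.2.1 h'.2.1

theorem posCount_of_pos {n : ℕ} {Q : Letter n → Prop} {p : Letter n} (hp : 0 < (p : ℤ))
    (h : Q p) : posCount Q = posCount (fun i => i ≠ p ∧ Q i) + 1 := by
  rw [posCount_split Q p, Nat.add_left_cancel_iff, posCount, Set.ncard_eq_one]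
  refine ⟨p, Set.ext fun i => ⟨fun h => h.2.1, ?_⟩⟩
  rintro rfl
  exact ⟨hp, rfl, h⟩

theorem posCount_of_neg {n : ℕ} {Q : Letter n → Prop} {p : Letter n} (h : ¬ Q p) :
    posCount Q = posCount (fun i => i ≠ p ∧ Q i) := by
  rw [posCount_split Q p, posCount_eq_zero (Q := fun i => i = p ∧ Q i), add_zero]
  rintro i - ⟨rfl, h'⟩
  exact h h'

/-- A pair with distinct entries avoids p, starts at p or ends at p. -/
theorem pairCount_split {n : ℕ} (Q : Letter n → Letter n → Prop) (p : Letter n)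
    (hp : 0 < (p : ℤ)) :
    pairCount Q = pairCount (fun i j => i ≠ p ∧ j ≠ p ∧ Q i j)
      + posCount (fun j => (p : ℤ) < j ∧ Q p j) + posCount (fun i => (i : ℤ) < p ∧ Q i p) := by
  have h1 : posCount (fun j => (p : ℤ) < j ∧ Q p j) = pairCount (fun i j => i = p ∧ Q i j) := by
    refine Set.ncard_congr (fun j _ => (p, j)) ?_ ?_ ?_
    · exact fun j hj => ⟨hp, hj.2.1, rfl, hj.2.2⟩
    · exact fun i j _ _ h => congrArg Prod.snd h
    · rintro ⟨i, j⟩ ⟨a1, a2, rfl, a3⟩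
      exact ⟨j, ⟨a1.trans a2, a2, a3⟩, rfl⟩
  have h2 : posCount (fun i => (i : ℤ) < p ∧ Q i p) = pairCount (fun i j => j = p ∧ Q i j) := by
    refine Set.ncard_congr (fun i _ => (i, p)) ?_ ?_ ?_
    · exact fun i hi => ⟨hi.1, hi.2.1, rfl, hi.2.2⟩
    · exact fun i j _ _ h => congrArg Prod.fst h
    · rintro ⟨i, j⟩ ⟨a1, a2, rfl, a3⟩
      exact ⟨i, ⟨a1, a2, a3⟩, rfl⟩
  rw [h1, h2]
  unfold pairCount
  rw [← Set.ncard_union_eq, ← Set.ncard_union_eq]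
  · congr 1
    ext ⟨i, j⟩
    simp only [Set.mem_ofPred_eq, Set.mem_union]
    tauto
  · rw [Set.disjoint_left]
    rintro ⟨i, j⟩ h ⟨-, h3, h4, -⟩
    rcases h with h | ⟨-, -, h5, -⟩
    · exact h.2.2.2.1 h4
    · simp only at h3 h4 h5
      rw [h4, h5] at h3
      exact lt_irrefl _ h3
  · rw [Set.disjoint_left]
    exact fun k h h' => h.2.2.1 h'.2.2.1

namespace IsInsertion

variable {n : ℕ} {c : Perm (Letter n)} {p M : Letter n}

/-- The map c restricts to a bijection from the positive letters other than p to those other than M.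
-/
theorem posCount_comp (hc : IsInsertion c p M) (Q : Letter n → Prop) :
    posCount (fun i => i ≠ p ∧ Q (c i)) = posCount (fun i => i ≠ M ∧ Q i) := by
  refine Set.ncard_congr (fun i _ => c i) ?_ ?_ ?_
  · rintro i ⟨h1, h2, h3⟩
    have h4 := (hc.mem_iff i).mpr ⟨h1, h2⟩
    exact ⟨h4.1, h4.2, h3⟩
  · exact fun i j _ _ h => c.injective h
  · rintro j ⟨h1, h2, h3⟩
    obtain ⟨i, rfl⟩ := c.surjective j
    have h4 := (hc.mem_iff i).mp ⟨h1, h2⟩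
    exact ⟨i, ⟨h4.1, h4.2, h3⟩, rfl⟩

theorem pairCount_comp (hc : IsInsertion c p M) (Q : Letter n → Letter n → Prop) :
    pairCount (fun i j => i ≠ p ∧ j ≠ p ∧ Q (c i) (c j))
      = pairCount (fun i j => i ≠ M ∧ j ≠ M ∧ Q i j) := by
  refine Set.ncard_congr (fun k _ => (c k.1, c k.2)) ?_ ?_ ?_
  · rintro ⟨i, j⟩ ⟨h1, h2, h3, h4, h5⟩
    have hj := h1.trans h2
    have h6 := (hc.mem_iff i).mpr ⟨h1, h3⟩
    have h7 := (hc.mem_iff j).mpr ⟨hj, h4⟩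
    exact ⟨h6.1, (hc.lt_iff i j h1 h3 hj h4).mpr h2, h6.2, h7.2, h5⟩
  · rintro ⟨i, j⟩ ⟨i', j'⟩ _ _ h
    rw [Prod.mk.injEq] at h ⊢
    exact ⟨c.injective h.1, c.injective h.2⟩
  · rintro ⟨i, j⟩ ⟨h1, h2, h3, h4, h5⟩
    have hj := h1.trans h2
    obtain ⟨i, rfl⟩ := c.surjective i
    obtain ⟨j, rfl⟩ := c.surjective j
    have h6 := (hc.mem_iff i).mp ⟨h1, h3⟩
    have h7 := (hc.mem_iff j).mp ⟨hj, h4⟩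
    exact ⟨(i, j), ⟨h6.1, (hc.lt_iff i j h6.1 h6.2 h7.1 h7.2).mp h2, h6.2, h7.2, h5⟩, rfl⟩

end IsInsertion

/-! ### Inversions and the statistic nmin under insertion. -/

theorem invD_eq {n : ℕ} (σ : Perm (Letter n)) :
    invD σ = pairCount (fun i j => (σ j : ℤ) < σ i) + pairCount (fun i j => (σ j : ℤ) < -σ i) := by
  simp only [invD, pairCount, ← Set.ncard_coe_finset, Finset.coe_filter, Finset.mem_univ, true_and]

theorem nminD_eq {n : ℕ} (σ : Perm (Letter n)) :
    nminD σ = posCount (fun i => ∃ j : Letter n, (i : ℤ) < j ∧ |(σ j : ℤ)| < σ i)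
      + posCount (fun i => (σ i : ℤ) < -1) := by
  simp only [nminD, posCount, ← Set.ncard_coe_finset, Finset.coe_filter, Finset.mem_univ, true_and]

/-- The word is ±1 2 3 ⋯ n, whose absolute values increase strictly. -/
theorem invD_of_mem_level_one {n : ℕ} {σ : Perm (Letter n)} (hσ : σ ∈ level n 1) :
    invD σ = 0 := by
  have key : ∀ i j : Letter n, 0 < (i : ℤ) → (i : ℤ) < j → |(σ i : ℤ)| < σ j := by
    intro i j hi hij
    rw [hσ.2 j (by push_cast; omega)]
    by_cases h : (1 : ℤ) < i
    · rw [hσ.2 i (by push_cast; omega), abs_of_pos hi]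
      exact hij
    · have := level_abs_le hσ i (by rw [abs_of_pos hi]; push_cast; omega)
      push_cast at this
      omega
  rw [invD_eq]
  unfold pairCount
  rw [Nat.add_eq_zero_iff, Set.ncard_eq_zero, Set.eq_empty_iff_forall_notMem, Set.ncard_eq_zero,
    Set.eq_empty_iff_forall_notMem]
  refine ⟨?_, ?_⟩ <;> rintro ⟨i, j⟩ ⟨h1, h2, h3⟩ <;>
    have := abs_lt.mp (key i j h1 h2) <;> simp only at h3 <;> omega

theorem nminD_of_mem_level_one {n : ℕ} {σ : Perm (Letter n)} (hσ : σ ∈ level n 1) :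
    nminD σ = 0 := by
  have key : ∀ i : Letter n, 0 < (i : ℤ) → |(σ i : ℤ)| = i := by
    intro i hi
    by_cases h : (1 : ℤ) < i
    · rw [hσ.2 i (by push_cast; omega), abs_of_pos hi]
    · have := level_abs_le hσ i (by rw [abs_of_pos hi]; push_cast; omega)
      have := abs_pos.mpr (σ i).2.1
      push_cast at *
      omega
  rw [nminD_eq, posCount_eq_zero, posCount_eq_zero]
  · intro i hi h
    by_cases h' : (1 : ℤ) < i
    · rw [hσ.2 i (by push_cast; omega)] at h
      omega
    · have h1 := key i hi
      have h2 := neg_abs_le (σ i : ℤ)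
      omega
  · rintro i hi ⟨j, hj, h⟩
    rw [key j (by omega)] at h
    have := le_abs_self (σ i : ℤ)
    rw [key i hi] at this
    omega

/-- Insertion of the letter `m + 1`, with the sign of `x`, at the position `|x|`. -/
theorem exists_insertion {n m : ℕ} (h : m < n) (x : Letter n) (hx : |(x : ℤ)| ≤ m + 1) :
    ∃ c ∈ level n (m + 1), c x = topLetter m h ∧
      (∀ y : Letter n, 0 < (y : ℤ) → (y : ℤ) < |(x : ℤ)| → c y = y) ∧
      (∀ y : Letter n, |(x : ℤ)| < y → (y : ℤ) ≤ m + 1 → (c y : ℤ) = y - 1) := by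
  -- The insertion written on all integers: x goes to m + 1, the positions beyond |x| up to m + 1
  -- shift down by one, and the negative side is filled in by oddness.
  let f : ℤ → ℤ := fun y =>
    if y = x then m + 1 else if y = -x then -(m + 1) else
    if |(x : ℤ)| < y ∧ y ≤ m + 1 then y - 1 else
    if |(x : ℤ)| < -y ∧ -y ≤ m + 1 then y + 1 else y
  have hx0 := abs_pos.mpr x.2.1
  have hf1 : ∀ y : Letter n, f y ≠ 0 ∧ |f y| ≤ n := by
    rintro ⟨y, hy0, hy⟩
    simp only [f]
    rw [abs_le] at hy ⊢
    rcases abs_choice (x : ℤ) with h' | h' <;> split_ifs <;> omega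
  have hf2 : ∀ y z : ℤ, f y = f z → y ≠ 0 → z ≠ 0 → y = z := by
    intro y z
    simp only [f]
    rcases abs_choice (x : ℤ) with h' | h' <;> split_ifs <;> omega
  have hf3 : ∀ y : ℤ, f (-y) = -f y := by
    intro y
    simp only [f]
    rcases abs_choice (x : ℤ) with h' | h' <;> split_ifs <;> omega
  let F : Letter n → Letter n := fun y => ⟨f y, hf1 y⟩
  have hF : Function.Bijective F := by
    rw [← Finite.injective_iff_bijective]
    intro y z hyz
    exact Subtype.ext (hf2 y z (congrArg Subtype.val hyz) y.2.1 z.2.1)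
  have hval : ∀ y, (Equiv.ofBijective F hF y : ℤ) = f y := fun _ => rfl
  refine ⟨Equiv.ofBijective F hF, ⟨fun y => Subtype.ext ?_, fun y hy => Subtype.ext ?_⟩,
    Subtype.ext ?_, fun y hy0 hy => Subtype.ext ?_, fun y hy hy' => ?_⟩
  · rw [hval, coe_neg, coe_neg, hval, hf3]
  · rw [hval]
    simp only [f]
    push_cast at hy
    rcases abs_choice (x : ℤ) with h' | h' <;> split_ifs <;> omega
  · rw [hval]
    simp [f]
  · rw [hval]
    simp only [f]
    rcases abs_choice (x : ℤ) with h' | h' <;> split_ifs <;> omega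
  · rw [hval]
    simp only [f]
    rcases abs_choice (x : ℤ) with h' | h' <;> split_ifs <;> omega

theorem coe_absLetter {n : ℕ} (x : Letter n) : (absLetter x : ℤ) = |(x : ℤ)| := rfl

theorem isInsertion_of {n m : ℕ} (h : m < n) {x : Letter n} (hx : |(x : ℤ)| ≤ m + 1)
    {c : Perm (Letter n)} (hc : c ∈ level n (m + 1)) (hcx : c x = topLetter m h)
    (h1 : ∀ y : Letter n, 0 < (y : ℤ) → (y : ℤ) < |(x : ℤ)| → c y = y)
    (h2 : ∀ y : Letter n, |(x : ℤ)| < y → (y : ℤ) ≤ m + 1 → (c y : ℤ) = y - 1) :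
    IsInsertion c (absLetter x) (topLetter m h) := by
  have hx0 := abs_pos.mpr x.2.1
  -- The values of c at positive positions other than |x|; the order and image conditions are read
  -- off from these three ranges.
  have val : ∀ y : Letter n, 0 < (y : ℤ) → y ≠ absLetter x →
      ((y : ℤ) < |(x : ℤ)| ∧ (c y : ℤ) = y) ∨ (|(x : ℤ)| < y ∧ (y : ℤ) ≤ m + 1 ∧ (c y : ℤ) = y - 1)
      ∨ ((m : ℤ) + 1 < y ∧ (c y : ℤ) = y) := by
    intro y hy hyx
    have : (y : ℤ) ≠ |(x : ℤ)| := fun h => hyx (Subtype.ext h)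
    rcases lt_or_gt_of_ne this with h3 | h3
    · exact Or.inl ⟨h3, by rw [h1 y hy h3]⟩
    · by_cases h4 : (y : ℤ) ≤ m + 1
      · exact Or.inr (Or.inl ⟨h3, h4, h2 y h3 h4⟩)
      · exact Or.inr (Or.inr ⟨by omega, by rw [hc.2 y (by push_cast; omega)]⟩)
  refine ⟨hx0, by rw [coe_topLetter]; omega, fun i => ?_, fun i j hi hi' hj hj' => ?_⟩
  · have e1 : c i ≠ topLetter m h ↔ (c i : ℤ) ≠ m + 1 := by rw [Ne, Subtype.ext_iff, coe_topLetter]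
    rw [e1]
    constructor
    · rintro ⟨h3, h4⟩
      have h5 : i ≠ absLetter x := by
        rintro rfl
        rcases abs_choice (x : ℤ) with h6 | h6
        · rw [show absLetter x = x from Subtype.ext h6, hcx, coe_topLetter] at h4
          exact h4 rfl
        · rw [show absLetter x = -x from Subtype.ext h6, level_neg hc, hcx, coe_neg,
            coe_topLetter] at h3
          omega
      refine ⟨?_, h5⟩
      by_contra h6
      have h7 : 0 < ((-i : Letter n) : ℤ) := by
        have := i.2.1
        rw [coe_neg]; omega
      by_cases h8 : -i = absLetter x
      · rcases abs_choice (x : ℤ) with h9 | h9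
        · rw [show absLetter x = x from Subtype.ext h9] at h8
          rw [← neg_neg i, h8, level_neg hc, hcx, coe_neg, coe_topLetter] at h3
          omega
        · rw [show absLetter x = -x from Subtype.ext h9, neg_inj] at h8
          rw [h8, hcx, coe_topLetter] at h4
          exact h4 rfl
      · have h9 := val (-i) h7 h8
        rw [level_neg hc, coe_neg, coe_neg] at h9
        rw [coe_neg] at h7
        omega
    · rintro ⟨h3, h4⟩
      have := val i h3 h4
      omega
  · have := val i hi hi'
    have := val j hj hj'
    omega

section

variable {n m : ℕ} {h : m < n} {x : Letter n} {c τ : Perm (Letter n)}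

theorem abs_insertion_le (hcl : c ∈ level n (m + 1))
    (hc : IsInsertion c (absLetter x) (topLetter m h)) (hτ : τ ∈ level n m) (i : Letter n)
    (hi : 0 < (i : ℤ)) (hi' : (i : ℤ) ≠ |(x : ℤ)|) (hi'' : (i : ℤ) ≤ m + 1) :
    |(τ (c i) : ℤ)| ≤ m := by
  have h1 := (hc.mem_iff i).mpr ⟨hi, fun h => hi' (by rw [h]; rfl)⟩
  have h2 : (c i : ℤ) ≠ m + 1 := fun h => h1.2 (Subtype.ext h)
  have h3 := level_abs_le hcl i (by rw [abs_of_pos hi]; push_cast; omega)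
  rw [abs_of_pos h1.1] at h3
  refine level_abs_le hτ _ ?_
  rw [abs_of_pos h1.1]
  push_cast at h3
  omega

/-- Let p = |x|. Pairs avoiding p match the pairs of τ avoiding M, and in τ no pair with M counts.
If x > 0, the new letter exceeds exactly the m + 1 - p later entries up to position m + 1, and
nothing else is added. If x < 0, each of the p - 1 earlier positions counts in both parts of the
inversion number and each of those m + 1 - p later ones in the second part, giving m + 1 + p - 2. -/
theorem invD_mul_insertion (hx : |(x : ℤ)| ≤ m + 1)
    (hcx : c x = topLetter m h) (hcl : c ∈ level n (m + 1))
    (hc : IsInsertion c (absLetter x) (topLetter m h)) (hτ : τ ∈ level n m) :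
    invD (τ * c) = invD τ + swapWeight x (topLetter m h) := by
  have hx0 := abs_pos.mpr x.2.1
  have hM : (τ (topLetter m h) : ℤ) = m + 1 := by
    rw [hτ.2 _ (by rw [coe_topLetter]; omega), coe_topLetter]
  have hbig : ∀ i : Letter n, (m : ℤ) + 1 < i → (τ (c i) : ℤ) = i := by
    intro i hi
    rw [hcl.2 i (by push_cast; omega), hτ.2 i (by omega)]
  have hsmall := abs_insertion_le hcl hc hτ
  have hτbig : ∀ i : Letter n, (m : ℤ) < i → (τ i : ℤ) = i := fun i hi => by rw [hτ.2 i hi]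
  have hτsmall : ∀ i : Letter n, 0 < (i : ℤ) → (i : ℤ) ≤ m → |(τ i : ℤ)| ≤ m :=
    fun i h0 hi => level_abs_le hτ _ (by rwa [abs_of_pos h0])
  -- In the word of τ, M exceeds every earlier entry in absolute value and is exceeded by every
  -- later one, so pairs with M drop out.
  have z1 : ∀ Q : Letter n → Letter n → Prop,
      (∀ i j : Letter n, 0 < (i : ℤ) → |(τ i : ℤ)| < τ j → ¬ Q i j) →
      pairCount Q = pairCount (fun i j => i ≠ topLetter m h ∧ j ≠ topLetter m h ∧ Q i j) := by
    intro Q hQ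
    rw [pairCount_split Q (topLetter m h) hc.pos', posCount_eq_zero, posCount_eq_zero, add_zero,
      add_zero]
    · intro i hi hi'
      rw [coe_topLetter] at hi'
      refine hQ i _ hi ?_ hi'.2
      have := hτsmall i hi (by omega)
      omega
    · intro j hj hj'
      rw [coe_topLetter] at hj'
      refine hQ _ j hc.pos' ?_ hj'.2
      rw [hM, hτbig j (by omega), abs_of_pos (by omega)]
      exact hj'.1
  rw [invD_eq, invD_eq, pairCount_split (fun i j => ((τ * c) j : ℤ) < (τ * c) i) (absLetter x) hc.pos,
    pairCount_split (fun i j => ((τ * c) j : ℤ) < -(τ * c) i) (absLetter x) hc.pos,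
    z1 (fun i j => (τ j : ℤ) < τ i), z1 (fun i j => (τ j : ℤ) < -τ i),
    ← hc.pairCount_comp, ← hc.pairCount_comp]
  rotate_left
  · intro i j _ hij
    have := abs_lt.mp hij
    omega
  · intro i j _ hij
    have := abs_lt.mp hij
    omega
  simp only [Perm.mul_apply, coe_absLetter]
  have c1 : posCount (fun j : Letter n => |(x : ℤ)| < j ∧ (j : ℤ) ≤ m + 1) = m + 1 - |(x : ℤ)|.toNat := by
    rw [← posCount_interval (n := n) (a := |(x : ℤ)|.toNat) (b := m + 1) h]
    refine posCount_congr fun i hi => ?_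
    push_cast
    omega
  have c2 : posCount (fun j : Letter n => (j : ℤ) < |(x : ℤ)|) = |(x : ℤ)|.toNat - 1 := by
    have := posCount_interval (n := n) (a := 0) (b := |(x : ℤ)|.toNat - 1) (by omega)
    rw [Nat.sub_zero] at this
    rw [← this]
    refine posCount_congr fun i hi => ?_
    omega
  rcases lt_or_gt_of_ne x.2.1 with hneg | hpos
  · have hp : (τ (c (absLetter x)) : ℤ) = -(m + 1) := by
      rw [show absLetter x = -x from Subtype.ext (abs_of_neg hneg), level_neg hcl, hcx,
        level_neg hτ, coe_neg, hM]
    simp only [hp]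
    rw [posCount_eq_zero (Q := fun j => |(x : ℤ)| < j ∧ (τ (c j) : ℤ) < -(m + 1)),
      posCount_congr (Q := fun i => (i : ℤ) < |(x : ℤ)| ∧ -((m : ℤ) + 1) < τ (c i))
        (Q' := fun j : Letter n => (j : ℤ) < |(x : ℤ)|),
      posCount_congr (Q := fun j => |(x : ℤ)| < j ∧ (τ (c j) : ℤ) < - -((m : ℤ) + 1))
        (Q' := fun j : Letter n => |(x : ℤ)| < j ∧ (j : ℤ) ≤ m + 1),
      posCount_congr (Q := fun i => (i : ℤ) < |(x : ℤ)| ∧ -((m : ℤ) + 1) < -τ (c i))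
        (Q' := fun j : Letter n => (j : ℤ) < |(x : ℤ)|), c1, c2]
    · rw [swapWeight, if_pos hneg, coe_topLetter]
      rw [abs_of_neg hneg] at *
      omega
    · intro i hi
      refine and_iff_left_of_imp fun h1 => ?_
      have := abs_le.mp (hsmall i hi (by omega) (by omega))
      omega
    · intro j hj
      refine and_congr_right fun h1 => ?_
      by_cases h2 : (j : ℤ) ≤ m + 1
      · have := abs_le.mp (hsmall j hj (by omega) h2)
        omega
      · rw [hbig j (by omega)]
        omega
    · intro i hi
      refine and_iff_left_of_imp fun h1 => ?_
      have := abs_le.mp (hsmall i hi (by omega) (by omega))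
      omega
    · rintro j hj ⟨h1, h3⟩
      by_cases h2 : (j : ℤ) ≤ m + 1
      · have := abs_le.mp (hsmall j hj (by omega) h2)
        omega
      · rw [hbig j (by omega)] at h3
        omega
  · have hp : (τ (c (absLetter x)) : ℤ) = m + 1 := by
      rw [show absLetter x = x from Subtype.ext (abs_of_pos hpos), hcx, hM]
    simp only [hp]
    rw [posCount_congr (Q := fun j => |(x : ℤ)| < j ∧ (τ (c j) : ℤ) < (m : ℤ) + 1)
        (Q' := fun j : Letter n => |(x : ℤ)| < j ∧ (j : ℤ) ≤ m + 1),
      posCount_eq_zero (Q := fun i => (i : ℤ) < |(x : ℤ)| ∧ (m : ℤ) + 1 < τ (c i)),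
      posCount_eq_zero (Q := fun j => |(x : ℤ)| < j ∧ (τ (c j) : ℤ) < -((m : ℤ) + 1)),
      posCount_eq_zero (Q := fun i => (i : ℤ) < |(x : ℤ)| ∧ (m : ℤ) + 1 < -τ (c i)), c1]
    · rw [swapWeight, if_neg (by omega), coe_topLetter]
      rw [abs_of_pos hpos] at *
      omega
    · rintro i hi ⟨h1, h3⟩
      have := abs_le.mp (hsmall i hi (by omega) (by omega))
      omega
    · rintro j hj ⟨h1, h3⟩
      by_cases h2 : (j : ℤ) ≤ m + 1
      · have := abs_le.mp (hsmall j hj (by omega) h2)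
        omega
      · rw [hbig j (by omega)] at h3
        omega
    · rintro i hi ⟨h1, h3⟩
      have := abs_le.mp (hsmall i hi (by omega) (by omega))
      omega
    · intro j hj
      refine and_congr_right fun h1 => ?_
      by_cases h2 : (j : ℤ) ≤ m + 1
      · have := abs_le.mp (hsmall j hj (by omega) h2)
        omega
      · rw [hbig j (by omega)]
        omega

/-- A positive new letter counts exactly when a smaller entry follows it, that is, unless x = m + 1.
A negative one counts once as a minus sign, because m ≥ 1 puts it below -1. The contributions of all
other positions are unchanged. -/
theorem nminD_mul_insertion (hm : 1 ≤ m) (hx : |(x : ℤ)| ≤ m + 1)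
    (hcx : c x = topLetter m h) (hcl : c ∈ level n (m + 1))
    (hc : IsInsertion c (absLetter x) (topLetter m h)) (hτ : τ ∈ level n m) :
    nminD (τ * c) = nminD τ + if x = topLetter m h then 0 else 1 := by
  have hx0 := abs_pos.mpr x.2.1
  have hM : (τ (topLetter m h) : ℤ) = m + 1 := by
    rw [hτ.2 _ (by rw [coe_topLetter]; omega), coe_topLetter]
  have hbig : ∀ i : Letter n, (m : ℤ) + 1 < i → (τ (c i) : ℤ) = i := by
    intro i hi
    rw [hcl.2 i (by push_cast; omega), hτ.2 i (by omega)]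
  have hsmall := abs_insertion_le hcl hc hτ
  have hpabs : |(τ (c (absLetter x)) : ℤ)| = m + 1 := by
    rcases abs_choice (x : ℤ) with h1 | h1
    · rw [show absLetter x = x from Subtype.ext h1, hcx, hM, abs_of_pos (by omega)]
    · rw [show absLetter x = -x from Subtype.ext h1, level_neg hcl, hcx, level_neg hτ, coe_neg, hM,
        abs_neg, abs_of_pos (by omega)]
  have e1 : posCount (fun i => i ≠ absLetter x ∧
        ∃ j : Letter n, (i : ℤ) < j ∧ |((τ * c) j : ℤ)| < (τ * c) i)
      = posCount (fun i => i ≠ topLetter m h ∧ ∃ j : Letter n, (i : ℤ) < j ∧ |(τ j : ℤ)| < τ i) := by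
    rw [← hc.posCount_comp (fun i => ∃ j : Letter n, (i : ℤ) < j ∧ |(τ j : ℤ)| < τ i)]
    refine posCount_congr fun i hi => and_congr_right fun hi' => ?_
    have hix : (i : ℤ) ≠ |(x : ℤ)| := fun h => hi' (Subtype.ext h)
    -- An entry above m + 1 sits at a position above m + 1, so the new letter is never the later
    -- smaller entry witnessing another position.
    have hlarge : (m : ℤ) + 1 < τ (c i) → (m : ℤ) + 1 < i := by
      intro h1
      by_contra h2
      have := abs_le.mp (hsmall i hi hix (by omega))
      omega
    simp only [Perm.mul_apply]
    constructor
    · rintro ⟨j, hj1, hj2⟩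
      have hj3 : j ≠ absLetter x := by
        rintro rfl
        rw [hpabs] at hj2
        have := hlarge hj2
        rw [coe_absLetter] at hj1
        omega
      exact ⟨c j, (hc.lt_iff i j hi hi' (by omega) hj3).mpr hj1, hj2⟩
    · rintro ⟨j, hj1, hj2⟩
      have hci := (hc.mem_iff i).mpr ⟨hi, hi'⟩
      have hj3 : j ≠ topLetter m h := by
        rintro rfl
        rw [hM, abs_of_pos (by omega)] at hj2
        have := hlarge hj2
        rw [hcl.2 i (by push_cast; omega), coe_topLetter] at hj1
        omega
      obtain ⟨k, rfl⟩ := c.surjective j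
      have hk := (hc.mem_iff k).mp ⟨by omega, hj3⟩
      exact ⟨k, (hc.lt_iff i k hi hi' hk.1 hk.2).mp hj1, hj2⟩
  have n1 : ¬ ∃ j : Letter n, ((topLetter m h : Letter n) : ℤ) < j ∧
      |(τ j : ℤ)| < τ (topLetter m h) := by
    rintro ⟨j, h1, h2⟩
    rw [coe_topLetter] at h1
    rw [hτ.2 j (by omega), hM, abs_of_pos (by omega)] at h2
    omega
  have e3 : posCount (fun i => i ≠ absLetter x ∧ ((τ * c) i : ℤ) < -1)
      = posCount (fun i => i ≠ topLetter m h ∧ (τ i : ℤ) < -1) :=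
    hc.posCount_comp (fun i => (τ i : ℤ) < -1)
  rw [nminD_eq, nminD_eq, posCount_of_neg
      (Q := fun i => ∃ j : Letter n, (i : ℤ) < j ∧ |(τ j : ℤ)| < τ i) n1,
    posCount_of_neg (Q := fun i => (τ i : ℤ) < -1) (p := topLetter m h) (by omega), ← e1, ← e3]
  rcases lt_or_gt_of_ne x.2.1 with hneg | hpos
  · have hp : ((τ * c) (absLetter x) : ℤ) = -(m + 1) := by
      rw [Perm.mul_apply, show absLetter x = -x from Subtype.ext (abs_of_neg hneg), level_neg hcl,
        hcx, level_neg hτ, coe_neg, hM]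
    rw [posCount_of_neg (Q := fun i => ∃ j : Letter n, (i : ℤ) < j ∧ |((τ * c) j : ℤ)| < (τ * c) i)
        (p := absLetter x),
      posCount_of_pos (Q := fun i => ((τ * c) i : ℤ) < -1) (p := absLetter x) hc.pos, if_neg]
    · omega
    · rintro rfl
      rw [coe_topLetter] at hneg
      omega
    · omega
    · rintro ⟨j, -, h2⟩
      have := abs_nonneg ((τ * c) j : ℤ)
      omega
  · have hxp : absLetter x = x := Subtype.ext (abs_of_pos hpos)
    have hp : ((τ * c) (absLetter x) : ℤ) = m + 1 := by rw [Perm.mul_apply, hxp, hcx, hM]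
    have habs := abs_of_pos hpos
    rw [posCount_of_neg (Q := fun i => ((τ * c) i : ℤ) < -1) (p := absLetter x) (by omega)]
    by_cases hxM : x = topLetter m h
    · rw [if_pos hxM, posCount_of_neg
        (Q := fun i => ∃ j : Letter n, (i : ℤ) < j ∧ |((τ * c) j : ℤ)| < (τ * c) i)
        (p := absLetter x)]
      · rfl
      rintro ⟨j, h1, h2⟩
      rw [hxp, hxM, coe_topLetter] at h1
      rw [hp, Perm.mul_apply, hbig j h1, abs_of_pos (by omega)] at h2
      omega
    · have hne : (x : ℤ) ≠ m + 1 := fun h => hxM (Subtype.ext h)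
      rw [if_neg hxM, posCount_of_pos
        (Q := fun i => ∃ j : Letter n, (i : ℤ) < j ∧ |((τ * c) j : ℤ)| < (τ * c) i)
        (p := absLetter x) hc.pos]
      · omega
      -- Position m + 1 lies to the right of x and carries an entry of absolute value at most m.
      · refine ⟨topLetter m h, by rw [hxp, coe_topLetter]; omega, ?_⟩
        have := hsmall (topLetter m h) hc.pos' (by rw [coe_topLetter]; omega) (by simp)
        rw [hp, Perm.mul_apply]
        omega

end

theorem sum_invD_nminD {n : ℕ} (hn : 1 ≤ n) {R : Type*} [CommRing R] (q t : R) :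
    ∑ σ : typeD n, q ^ invD (σ : Perm (Letter n)) * t ^ nminD (σ : Perm (Letter n))
      = ∏ r ∈ Finset.Icc 1 (n - 1), (1 + q ^ r * t + q * t * qInt q (2 * r)) := by
  refine sum_typeD_eq_prod hn invD nminD
    (fun σ hσ => ⟨invD_of_mem_level_one hσ, nminD_of_mem_level_one hσ⟩) ?_ q t
  intro m h hm x hx
  obtain ⟨c, hc, hcx, h1, h2⟩ := exists_insertion h x hx
  have hins := isInsertion_of h hx hc hcx h1 h2
  exact ⟨c, hc, hcx, fun τ hτ => ⟨invD_mul_insertion hx hcx hc hins hτ,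
    nminD_mul_insertion hm hx hcx hc hins hτ⟩⟩

/-! ### From generating functions to equidistribution. -/

open Polynomial in
/-- Two pairs of statistics with the same generating function are equidistributed. -/
theorem card_eq_of_sum_eq {α : Type*} [Fintype α] (a b a' b' : α → ℕ)
    (h : ∀ q t : ℤ[X][X], ∑ s, q ^ a s * t ^ b s = ∑ s, q ^ a' s * t ^ b' s) (i j : ℕ) :
    Nat.card {s // a s = i ∧ b s = j} = Nat.card {s // a' s = i ∧ b' s = j} := by
  classical
  -- With q the inner and t the outer variable of ℤ[X][X], the coefficient of q^i t^j counts the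
  -- elements with statistics (i, j).
  have key : ∀ f g : α → ℕ, ((∑ s, (C X : ℤ[X][X]) ^ f s * X ^ g s).coeff j).coeff i
      = (Nat.card {s // f s = i ∧ g s = j} : ℤ) := by
    intro f g
    rw [Nat.card_eq_fintype_card, Fintype.card_subtype, Finset.card_filter]
    simp only [finsetSum_coeff, ← C_pow, coeff_C_mul, coeff_X_pow]
    push_cast
    refine Finset.sum_congr rfl fun s _ => ?_
    by_cases h1 : j = g s
    · by_cases h2 : i = f s
      · simp [h1, h2]
      · simp [h1, h2, Ne.symm h2, coeff_X_pow]
    · simp [h1, Ne.symm h1]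
  have h1 := key a b
  rw [h, key a' b'] at h1
  exact_mod_cast h1.symm

end TypeD
open TypeD in
theorem mainTheorem6 (n : ℕ) (hn : 2 ≤ n) :
    (∀ a b : ℕ,
      Nat.card {σ : typeD n // invD (σ : Equiv.Perm (Letter n)) = a ∧
          nminD (σ : Equiv.Perm (Letter n)) = b}
        = Nat.card {σ : typeD n // sorD σ = a ∧ reflLenD σ = b}) ∧
    (∀ (R : Type*) [CommRing R] (q t : R),
      ∑ σ : typeD n, q ^ invD (σ : Equiv.Perm (Letter n)) * t ^ nminD (σ : Equiv.Perm (Letter n))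
        = ∏ r ∈ Finset.Icc 1 (n - 1), (1 + q ^ r * t + q * t * qInt q (2 * r)) ∧
      ∑ σ : typeD n, q ^ sorD σ * t ^ reflLenD σ
        = ∏ r ∈ Finset.Icc 1 (n - 1), (1 + q ^ r * t + q * t * qInt q (2 * r))) :=
  ⟨card_eq_of_sum_eq _ _ _ _ fun q t => by
    rw [sum_invD_nminD (by omega), sum_sorD_reflLenD (by omega)],
    fun _ _ q t => ⟨sum_invD_nminD (by omega) q t, sum_sorD_reflLenD (by omega) q t⟩⟩
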